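/- All spaces are real Banach spaces. A \emph{double arrow} $(f,\overline f):A\leftrightarrows B$ is a pair of operators $f:A\to B$, $\overline f:B\to A$ such that $f$ is a linear into isometry, $\|\overline f\|\le 1$ and $\overline f f=1_A$. A Banach space $E$ has a \emph{skeleton} if $E=\overline{\bigcup_n E_n}$ for an increasing sequence $(E_n)_{n\in\mathbb N}$ of finite-dimensional subspaces such that each inclusion $E_n\to E_{n+1}$ is the first component of a double arrow $E_n\leftrightarrows E_{n+1}$. It has an \emph{$\omega$-skeleton} if $E=\overline{\bigcup_{\alpha<\omega_1}E_\alpha}$ for an increasing chain $(E_\alpha)_{\alpha<\omega_1}$ of closed separable subspaces such that $E_\beta=\overline{\bigcup_{\alpha<\beta}E_\alpha}$ for every limit ordinal $\beta<\omega_1$ and each inclusion $E_\alpha\to E_{\alpha+1}$ is the first component of a double arrow $E_\alpha\leftrightarrows E_{\alpha+1}$. $E$ has the \emph{BAP} if there is $\lambda$ such that for every finite-dimensional subspace $F\subset E$ and every $\lambda'>\lambda$ there is a finite-rank operator $T:E\to E$ with $\|T\|\le\lambda'$ and $Tx=x$ for all $x\in F$. Given operators $i:Y\to A$ and $j:Y\to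 B$, their push-out is the quotient of $A\oplus_1 B$ by the closure of $\{(iy,-jy):y\in Y\}$, with the canonical map $B\to \mathrm{PO}$, $b\mapsto[(0,b)]$. For a Banach space $X$, the space $\mathscr K_{\omega_1}(X)$ is constructed as follows. Put $P_0=X$. Given $P_\alpha$, $\alpha<\omega_1$, let $I_\alpha$ be the set of all pairs $(d,(u,\overline u))$ in which $d:F_u\to P_\alpha$ is the first component of some double arrow $F_u\leftrightarrows P_\alpha$ and $(u,\overline u):F_u\leftrightarrows G_u$ is a double arrow, where $F_u$, $G_u$ run through all the finite-dimensional Banach spaces of the form $(\mathbb R^n,\|\cdot\|)$, with $n\ge 0$ and $\|\cdot\|$ any norm on $\mathbb R^n$. Let $P_{\alpha+1}$ be the push-out of $\bigoplus u:\ell_1(I_\alpha,F_u)\to\ell_1(I_\alpha,G_u)$ and $\sum d:\ell_1(I_\alpha,F_u)\to P_\alpha$; the canonical map $P_\alpha\to P_{\alpha+1}$ is an into isometry. At limit ordinals $\beta<\omega_1$ put $P_\beta=\overline{\bigcup_{\alpha<\beta}P_\alpha}$, and finally $\mathscr K_{\omega_1}(X)=\overline{\bigcup_{\alpha<\omega_1}P_\alpha}$.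 \textbf{Proposition.} Assume the continuum hypothesis $2^{\aleph_0}=\aleph_1$, and let $X$ be a Banach space. (1) If $X$ has an $\omega$-skeleton, then $\mathscr K_{\omega_1}(X)$ has an $\omega$-skeleton. (2) If $X$ has a skeleton, then $\mathscr K_{\omega_1}(X)$ has the BAP. -/

import Mathlib

open CategoryTheory CategoryTheory.Limits
open scoped ENNReal Cardinal Ordinal

universe u v

set_option linter.unusedSectionVars false

noncomputable section

namespace ComplDisp

/-! ## Double arrows, skeletons, bounded approximation property -/

/-- A double arrow `A ⇄ B`: an into isometry `emb : A → B` together with an operator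
`proj : B → A` of norm at most one such that `proj ∘ emb = 1`. -/
structure DoubleArrow (A : Type u) (B : Type v) [NormedAddCommGroup A] [NormedSpace ℝ A]
    [NormedAddCommGroup B] [NormedSpace ℝ B] where
  emb : A →ₗᵢ[ℝ] B
  proj : B →L[ℝ] A
  norm_proj_le : ‖proj‖ ≤ 1
  proj_emb : ∀ a, proj (emb a) = a

/-- `E` admits a skeleton: it is the closure of the union of an increasing sequence of
finite-dimensional subspaces, each being the range of a double arrow into the next one
(whose embedding is the inclusion). -/
def HasSkeleton (E : Type u) [NormedAddCommGroup E] [NormedSpace ℝ E] : Prop :=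
  ∃ S : ℕ → Submodule ℝ E,
    (∀ n, FiniteDimensional ℝ (S n)) ∧
    Monotone S ∧
    (∀ n, ∃ δ : DoubleArrow (S n) (S (n + 1)), ∀ x : S n, (δ.emb x : E) = x) ∧
    closure (⋃ n, (S n : Set E)) = Set.univ

/-- `E` admits an `ω`-skeleton: it is the closure of the union of an increasing continuous
chain `(S α)` (`α < ω₁`) of closed separable subspaces, each being the range of a double arrow
into the next one (whose embedding is the inclusion). Values of `S` at ordinals `α ≥ ω₁` are
irrelevant. -/
def HasOmegaSkeleton (E : Type u) [NormedAddCommGroup E] [NormedSpace ℝ E] : Prop :=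
  ∃ S : Ordinal.{0} → Submodule ℝ E,
    (∀ α < ω₁, IsClosed (S α : Set E) ∧ TopologicalSpace.IsSeparable (S α : Set E)) ∧
    (∀ α β, α ≤ β → β < ω₁ → S α ≤ S β) ∧
    (∀ α < ω₁, ∃ δ : DoubleArrow (S α) (S (Order.succ α)), ∀ x : S α, (δ.emb x : E) = x) ∧
    (∀ β < ω₁, Order.IsSuccLimit β → (S β : Set E) = closure (⋃ α < β, (S α : Set E))) ∧
    closure (⋃ α < ω₁, (S α : Set E)) = Set.univ

/-- The `lam`-bounded approximation property. -/
def HasBAPWith (lam : ℝ) (E : Type u) [NormedAddCommGroup E] [NormedSpace ℝ E] : Prop :=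
  ∀ F : Submodule ℝ E, FiniteDimensional ℝ F → ∀ lam' > lam,
    ∃ T : E →L[ℝ] E, FiniteDimensional ℝ T.range ∧ ‖T‖ ≤ lam' ∧ ∀ x ∈ F, T x = x

/-- The bounded approximation property. -/
def HasBAP (E : Type u) [NormedAddCommGroup E] [NormedSpace ℝ E] : Prop :=
  ∃ lam : ℝ, HasBAPWith lam E

/-! ## `ℓ₁`-sums and push-outs -/

section EllOne

variable {I : Type u} {E E' : I → Type v}
  [∀ i, NormedAddCommGroup (E i)] [∀ i, NormedSpace ℝ (E i)]
  [∀ i, NormedAddCommGroup (E' i)] [∀ i, NormedSpace ℝ (E' i)]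

theorem ellOne_summable_norm (f : lp E 1) : Summable fun i => ‖f i‖ := by
  simpa using (lp.memℓp f).summable (by simp)

theorem ellOne_norm_eq (f : lp E 1) : ‖f‖ = ∑' i, ‖f i‖ := by
  simp [lp.norm_eq_tsum_rpow (p := 1) (by simp) f]

/-- The vector sum `⊕ u i : ℓ₁(E i) → ℓ₁(E' i)` of a family of into isometries. -/
def ellOneMap (φ : ∀ i, E i →ₗᵢ[ℝ] E' i) : lp E 1 →ₗᵢ[ℝ] lp E' 1 where
  toFun f := ⟨fun i => φ i (f i), memℓp_gen (by simpa using ellOne_summable_norm f)⟩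
  map_add' f g := by ext i; exact map_add (φ i) (f i) (g i)
  map_smul' c f := by ext i; exact map_smul (φ i) c (f i)
  norm_map' f := by
    rw [ellOne_norm_eq, ellOne_norm_eq]
    exact tsum_congr fun i => (φ i).norm_map (f i)

@[simp] theorem ellOneMap_apply (φ : ∀ i, E i →ₗᵢ[ℝ] E' i) (f : lp E 1) (i : I) :
    ellOneMap φ f i = φ i (f i) := rfl

variable {P : Type*} [NormedAddCommGroup P] [NormedSpace ℝ P] [CompleteSpace P]

theorem ellOneSum_summable (d : ∀ i, E i →ₗᵢ[ℝ] P) (f : lp E 1) :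
    Summable fun i => d i (f i) :=
  Summable.of_norm (by simpa using ellOne_summable_norm f)

theorem ellOneSum_norm_le (d : ∀ i, E i →ₗᵢ[ℝ] P) (f : lp E 1) :
    ‖∑' i, d i (f i)‖ ≤ ‖f‖ := by
  rw [ellOne_norm_eq]
  refine (norm_tsum_le_tsum_norm (by simpa using ellOne_summable_norm f)).trans (le_of_eq ?_)
  exact tsum_congr fun i => (d i).norm_map (f i)

/-- The sum `∑ d i : ℓ₁(E i) → P` of a family of into isometries, a contractive operator. -/
def ellOneSum (d : ∀ i, E i →ₗᵢ[ℝ] P) : lp E 1 →L[ℝ] P :=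
  LinearMap.mkContinuous
    { toFun := fun f => ∑' i, d i (f i)
      map_add' := fun f g => by
        rw [← (ellOneSum_summable d f).tsum_add (ellOneSum_summable d g)]
        simp
      map_smul' := fun c f => by
        rw [RingHom.id_apply, ← (ellOneSum_summable d f).tsum_const_smul c]
        simp }
    1 (fun f => by simpa using ellOneSum_norm_le d f)

@[simp] theorem ellOneSum_apply (d : ∀ i, E i →ₗᵢ[ℝ] P) (f : lp E 1) :
    ellOneSum d f = ∑' i, d i (f i) := rfl

end EllOne

section Pushout

variable {Y A B : Type*} [NormedAddCommGroup Y] [NormedSpace ℝ Y]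
  [NormedAddCommGroup A] [NormedSpace ℝ A] [NormedAddCommGroup B] [NormedSpace ℝ B]

/-- `Δ = {(i y, -j y) : y ∈ Y}`, a subspace of `A ⊕₁ B`. -/
def pushoutDelta (i : Y →L[ℝ] A) (j : Y →L[ℝ] B) : Submodule ℝ (WithLp 1 (A × B)) :=
  LinearMap.range
    ((WithLp.linearEquiv 1 ℝ (A × B)).symm.toLinearMap ∘ₗ
      (i.toLinearMap.prod (-j.toLinearMap)))

/-- The push-out space of `i : Y → A` and `j : Y → B`: the quotient of `A ⊕₁ B` by the closure
of `Δ = {(i y, -j y) : y ∈ Y}`. -/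
abbrev Pushout (i : Y →L[ℝ] A) (j : Y →L[ℝ] B) : Type _ :=
  WithLp 1 (A × B) ⧸ (pushoutDelta i j).topologicalClosure

instance pushoutClosed (i : Y →L[ℝ] A) (j : Y →L[ℝ] B) :
    IsClosed ((pushoutDelta i j).topologicalClosure : Set (WithLp 1 (A × B))) :=
  Submodule.isClosed_topologicalClosure _

theorem pushout_norm_ge (i : Y →ₗᵢ[ℝ] A) (j : Y →L[ℝ] B) (hj : ∀ y, ‖j y‖ ≤ ‖y‖) (b : B)
    (m : WithLp 1 (A × B))
    (hm : m ∈ (pushoutDelta i.toContinuousLinearMap j).topologicalClosure) :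
    ‖b‖ ≤ ‖WithLp.toLp 1 ((0 : A), b) + m‖ := by
  have hcl : IsClosed {m : WithLp 1 (A × B) | ‖b‖ ≤ ‖WithLp.toLp 1 ((0 : A), b) + m‖} :=
    isClosed_le continuous_const (by fun_prop)
  have hsub : (pushoutDelta i.toContinuousLinearMap j : Set (WithLp 1 (A × B))) ⊆
      {m | ‖b‖ ≤ ‖WithLp.toLp 1 ((0 : A), b) + m‖} := by
    rintro _ ⟨y, rfl⟩
    simp only [Set.mem_ofPred_eq, WithLp.prod_norm_eq_of_L1]
    simp only [WithLp.add_fst, WithLp.add_snd]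
    change ‖b‖ ≤ ‖(0 : A) + i y‖ + ‖b + -(j y)‖
    rw [zero_add, i.norm_map]
    have h1 : ‖b‖ ≤ ‖b + -(j y)‖ + ‖j y‖ := by
      simpa using norm_add_le (b + -(j y)) (j y)
    have h2 := hj y
    linarith
  exact closure_minimal hsub hcl hm

/-- The canonical map `B → PO`, `b ↦ (0, b) + closure Δ`. It is an into isometry
when `i` is an into isometry and `j` is contractive. -/
def pushoutInr (i : Y →ₗᵢ[ℝ] A) (j : Y →L[ℝ] B) (hj : ∀ y, ‖j y‖ ≤ ‖y‖) :
    B →ₗᵢ[ℝ] Pushout i.toContinuousLinearMap j where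
  toLinearMap :=
    (pushoutDelta i.toContinuousLinearMap j).topologicalClosure.mkQ ∘ₗ
      (WithLp.linearEquiv 1 ℝ (A × B)).symm.toLinearMap ∘ₗ LinearMap.inr ℝ A B
  norm_map' b := by
    change ‖(Submodule.Quotient.mk (WithLp.toLp 1 ((0 : A), b)) :
      Pushout i.toContinuousLinearMap j)‖ = ‖b‖
    apply le_antisymm
    · refine (Submodule.Quotient.norm_mk_le _ _).trans (le_of_eq ?_)
      simp
    · refine le_of_forall_pos_le_add fun ε hε => ?_
      obtain ⟨m, hm, hlt⟩ := Submodule.Quotient.norm_mk_lt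
        (Submodule.Quotient.mk (WithLp.toLp 1 ((0 : A), b)) :
          Pushout i.toContinuousLinearMap j) hε
      have hmem := (Submodule.Quotient.eq _).1 hm
      have := pushout_norm_ge i j hj b _ hmem
      rw [add_sub_cancel] at this
      exact this.trans hlt.le

end Pushout

/-! ## The successor step -/

/-- A finite-dimensional Banach space, presented as `ℝⁿ` with an arbitrary norm. Up to linear
isometry these are all finite-dimensional real Banach spaces, and they form a set. -/
structure FinDimSpace : Type where
  dim : ℕ
  norm : Seminorm ℝ (Fin dim → ℝ)
  eq_zero_of_norm : ∀ x, norm x = 0 → x = 0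

/-- The underlying vector space `ℝⁿ` (a type synonym, so as not to carry the sup norm). -/
def FinDimSpace.Space (F : FinDimSpace) : Type := Fin F.dim → ℝ

namespace FinDimSpace

variable (F : FinDimSpace)

instance : AddCommGroup F.Space := inferInstanceAs (AddCommGroup (Fin F.dim → ℝ))

instance : Module ℝ F.Space := inferInstanceAs (Module ℝ (Fin F.dim → ℝ))

instance : Norm F.Space := ⟨fun x => F.norm x⟩

theorem core : NormedSpace.Core ℝ F.Space where
  norm_nonneg x := apply_nonneg F.norm x
  norm_smul c x := map_smul_eq_mul F.norm c x
  norm_triangle x y := map_add_le_add F.norm x y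
  norm_eq_zero_iff x := ⟨F.eq_zero_of_norm x, fun h => by subst h; exact map_zero F.norm⟩

instance : NormedAddCommGroup F.Space := NormedAddCommGroup.ofCore F.core

instance : NormedSpace ℝ F.Space := NormedSpace.ofCore F.core

end FinDimSpace

/-- The index set `I(P)` of the push-out performed on the space `P`: its elements are the
into isometries `d : F → P`, `F` finite-dimensional, which are the first component of some double
arrow `F ⇄ P`, each of them repeated as many times as there are double arrows `u : F ⇄ G` into
finite-dimensional spaces `G`. -/
structure ArrowIndex (P : Type u) [NormedAddCommGroup P] [NormedSpace ℝ P] : Type u where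
  F : FinDimSpace
  G : FinDimSpace
  u : DoubleArrow F.Space G.Space
  d : F.Space →ₗᵢ[ℝ] P
  complemented : ∃ a : DoubleArrow F.Space P, a.emb = d

section Step

variable (P : Type u) [NormedAddCommGroup P] [NormedSpace ℝ P] [CompleteSpace P]

/-- `⊕ u : ℓ₁(I, F_u) → ℓ₁(I, G_u)`. -/
def stepTop : lp (fun a : ArrowIndex P => a.F.Space) 1 →ₗᵢ[ℝ]
    lp (fun a : ArrowIndex P => a.G.Space) 1 :=
  ellOneMap fun a => a.u.emb

/-- `∑ d : ℓ₁(I, F_u) → P`. -/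
def stepLeft : lp (fun a : ArrowIndex P => a.F.Space) 1 →L[ℝ] P :=
  ellOneSum fun a => a.d

/-- The successor `P_{α+1}` of `P = P_α`: the push-out of `⊕ u` and `∑ d`. -/
abbrev Step : Type u := Pushout (stepTop P).toContinuousLinearMap (stepLeft P)

instance : CompleteSpace (Step P) :=
  haveI : CompleteSpace (lp (fun a : ArrowIndex P => a.G.Space) 1) :=
    haveI : ∀ a : ArrowIndex P, CompleteSpace a.G.Space := fun a =>
      haveI : FiniteDimensional ℝ a.G.Space :=
        inferInstanceAs (FiniteDimensional ℝ (Fin a.G.dim → ℝ))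
      FiniteDimensional.complete ℝ a.G.Space
    inferInstance
  inferInstance

/-- The canonical into isometry `P_α → P_{α+1}`. -/
def toStep : P →ₗᵢ[ℝ] Step P :=
  pushoutInr (stepTop P) (stepLeft P) fun f => ellOneSum_norm_le _ f

end Step

/-! ## Banach spaces and into isometries; limits of chains -/

/-- A (bundled, real) Banach space. -/
structure Ban : Type (u + 1) where
  carrier : Type u
  [normed : NormedAddCommGroup carrier]
  [space : NormedSpace ℝ carrier]
  [complete : CompleteSpace carrier]

namespace Ban

instance : CoeSort Ban.{u} (Type u) := ⟨Ban.carrier⟩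

attribute [instance] Ban.normed Ban.space Ban.complete

/-- The category of Banach spaces and linear into isometries. -/
instance : Category Ban.{u} where
  Hom A B := A →ₗᵢ[ℝ] B
  id A := LinearIsometry.id
  comp f g := LinearIsometry.comp g f

/-- The linear into isometry underlying a morphism. -/
def iso {A B : Ban.{u}} (f : A ⟶ B) : A →ₗᵢ[ℝ] B := f

@[simp] theorem iso_comp {A B C : Ban.{u}} (f : A ⟶ B) (g : B ⟶ C) (x : A) :
    iso (f ≫ g) x = iso g (iso f x) := rfl

@[simp] theorem iso_id {A : Ban.{u}} (x : A) : iso (𝟙 A) x = x := rfl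

theorem hom_ext {A B : Ban.{u}} {f g : A ⟶ B} (h : ∀ x, iso f x = iso g x) : f = g :=
  LinearIsometry.ext h

section Colimit

variable {J : Type} [LinearOrder J] [Nonempty J] (D : J ⥤ Ban.{u})

/-- The isometric inclusions of a chain of Banach spaces. -/
def trans (i j : J) (h : i ≤ j) : D.obj i →ₗᵢ[ℝ] D.obj j := iso (D.map (homOfLE h))

instance directed : DirectedSystem (fun j => D.obj j) (fun i j h => trans D i j h) where
  map_self i x := by
    change iso (D.map (𝟙 i)) x = x
    simp
  map_map k j i hij hjk x := by
    change iso (D.map (homOfLE hjk)) (iso (D.map (homOfLE hij)) x) = _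
    rw [← iso_comp, ← D.map_comp]
    rfl

/-- The union of a chain of Banach spaces and isometric inclusions, as a vector space. -/
abbrev Union : Type u := DirectLimit (fun j => D.obj j) (trans D)

instance : Norm (Union D) :=
  ⟨DirectLimit.lift (trans D) (fun _ x => ‖x‖) fun i j h x => ((trans D i j h).norm_map x).symm⟩

theorem union_norm_mk (i : J) (x : D.obj i) : ‖(⟦⟨i, x⟩⟧ : Union D)‖ = ‖x‖ := rfl

theorem unionCore : NormedSpace.Core ℝ (Union D) where
  norm_nonneg := DirectLimit.induction _ fun i x => norm_nonneg x
  norm_smul c := DirectLimit.induction _ fun i x => by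
    rw [DirectLimit.smul_def, union_norm_mk, union_norm_mk, norm_smul]
  norm_triangle := DirectLimit.induction₂ _ fun i x y => by
    rw [DirectLimit.add_def, union_norm_mk, union_norm_mk, union_norm_mk]
    exact norm_add_le x y
  norm_eq_zero_iff := DirectLimit.induction _ fun i x => by
    rw [union_norm_mk, norm_eq_zero]
    refine ⟨fun h => by rw [h, DirectLimit.zero_def i], fun h => ?_⟩
    have h' := congrArg norm h
    rw [union_norm_mk, DirectLimit.zero_def i, union_norm_mk, norm_zero, norm_eq_zero] at h'
    exact h'

instance : NormedAddCommGroup (Union D) := NormedAddCommGroup.ofCore (unionCore D)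

instance : NormedSpace ℝ (Union D) := NormedSpace.ofCore (unionCore D)

/-- The inclusion of a member of the chain in the union. -/
def toUnion (i : J) : D.obj i →ₗᵢ[ℝ] Union D where
  toLinearMap := DirectLimit.Module.of ℝ J (fun j => D.obj j) (trans D) i
  norm_map' _ := rfl

/-- The completion of the union of a chain. -/
def limitObj : Ban.{u} := ⟨UniformSpace.Completion (Union D)⟩

/-- The cocone of the inclusions in the completion of the union. -/
def limitCocone : Cocone D where
  pt := limitObj D
  ι :=
    { app := fun j => (UniformSpace.Completion.toComplₗᵢ (𝕜 := ℝ) (E := Union D)).comp (toUnion D j)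
      naturality := fun i j f => by
        refine hom_ext fun x => ?_
        change ((toUnion D j (iso (D.map f) x) : Union D) : UniformSpace.Completion (Union D)) =
          ((toUnion D i x : Union D) : UniformSpace.Completion (Union D))
        have h : toUnion D j (trans D i j (leOfHom f) x) = toUnion D i x := by
          change (⟦⟨j, trans D i j (leOfHom f) x⟩⟧ : Union D) = ⟦⟨i, x⟩⟧
          exact DirectLimit.mk_apply _ _ _ _
        exact congrArg _ h }

/-- The isometry on the union induced by a cocone. -/
def unionDesc (s : Cocone D) : Union D →ₗᵢ[ℝ] s.pt where
  toLinearMap := DirectLimit.Module.lift ℝ J (fun j => D.obj j) (trans D)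
    (fun j => (iso (s.ι.app j)).toLinearMap) fun i j h x => by
      change iso (s.ι.app j) (iso (D.map (homOfLE h)) x) = iso (s.ι.app i) x
      rw [← iso_comp, s.w]
  norm_map' := DirectLimit.induction _ fun i x => (iso (s.ι.app i)).norm_map x

/-- The isometry on the completion of the union induced by a cocone. -/
def limitDesc (s : Cocone D) : UniformSpace.Completion (Union D) →ₗᵢ[ℝ] s.pt where
  toLinearMap := ((unionDesc D s).toContinuousLinearMap.extend
    (UniformSpace.Completion.toComplL (𝕜 := ℝ) (E := Union D))).toLinearMap
  norm_map' x := by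
    induction x using UniformSpace.Completion.induction_on with
    | hp => exact isClosed_eq (by fun_prop) continuous_norm
    | ih a =>
      change ‖(unionDesc D s).toContinuousLinearMap.extend
        (UniformSpace.Completion.toComplL (𝕜 := ℝ) (E := Union D))
        (UniformSpace.Completion.toComplL (𝕜 := ℝ) (E := Union D) a)‖ = _
      rw [ContinuousLinearMap.extend_eq _ UniformSpace.Completion.denseRange_coe
        (UniformSpace.Completion.isUniformInducing_coe _), UniformSpace.Completion.norm_coe]
      exact (unionDesc D s).norm_map a

theorem limitDesc_coe (s : Cocone D) (a : Union D) :
    limitDesc D s (a : UniformSpace.Completion (Union D)) = unionDesc D s a :=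
  ContinuousLinearMap.extend_eq (unionDesc D s).toContinuousLinearMap
    (e := UniformSpace.Completion.toComplL (𝕜 := ℝ) (E := Union D))
    UniformSpace.Completion.denseRange_coe (UniformSpace.Completion.isUniformInducing_coe _) a

/-- The completion of the union of a chain is its colimit. -/
def limitIsColimit : IsColimit (limitCocone D) where
  desc s := limitDesc D s
  fac s j := hom_ext fun x => limitDesc_coe D s (toUnion D j x)
  uniq s m hm := by
    refine hom_ext fun x => ?_
    change iso m x = limitDesc D s x
    induction x using UniformSpace.Completion.induction_on with
    | hp => exact isClosed_eq (iso m).continuous (limitDesc D s).continuous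
    | ih a =>
      rw [limitDesc_coe]
      induction a using DirectLimit.induction with
      | ih i x => exact congrArg (fun f => iso f x) (hm i)

theorem hasColimitsOfShape : HasColimitsOfShape J Ban.{u} :=
  ⟨fun D => ⟨⟨⟨limitCocone D, limitIsColimit D⟩⟩⟩⟩

end Colimit

end Ban

/-! ## The space `𝒦_{ω₁}(X)` -/

/-- The well-ordered set of countable ordinals. -/
abbrev CountableOrdinals : Type := (ω₁ : Ordinal.{0}).ToType

instance : Nonempty CountableOrdinals :=
  Ordinal.nonempty_toType_iff.2 (Ordinal.omega_pos 1).ne'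

instance : OrderBot CountableOrdinals := WellFoundedLT.toOrderBot _

instance : HasIterationOfShape CountableOrdinals Ban.{u} where
  hasColimitsOfShape_of_isSuccLimit j hj :=
    haveI : Nonempty (Set.Iio j) := ⟨⟨⊥, hj.bot_lt⟩⟩
    Ban.hasColimitsOfShape
  hasColimitsOfShape := Ban.hasColimitsOfShape

section K

variable (X : Type u) [NormedAddCommGroup X] [NormedSpace ℝ X] [CompleteSpace X]

/-- The data of the construction: `P₀ = X`, and `P_α → P_{α+1}` is the push-out step. -/
def succStruct : SmallObject.SuccStruct Ban.{u} where
  X₀ := ⟨X⟩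
  succ P := ⟨Step P⟩
  toSucc P := toStep P

/-- The space `𝒦_{ω₁}(X)`: the push-out step is iterated `ω₁` times starting from `X`, the spaces
at limit stages (including `ω₁`) being the completions of the unions of the previous ones. -/
def KOmegaOne : Ban.{u} := (succStruct X).iteration CountableOrdinals

end K

end ComplDisp

end

/-!
The space `𝒦_{ω₁}(X)` is the union of a continuous chain `(V j)` of closed subspaces, indexed by the
countable ordinals, in which `V (succ j)` arises from `V j` by attaching finite-dimensional spaces
`G a` along `1`-complemented subspaces `F a` of theirs. All that is used about it is recorded in the
structure `PushoutTower`; the main point is the universal property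
`PushoutTower.extend` of the push-out, by which an operator on `V j` extends to `V (succ j)`, without
increase of the bound, as soon as it is prescribed on each `G a` compatibly with its values on `F a`.

Operators are extended along the tower by transfinite recursion (`exists_transfinite_extension`): on
some of the spaces `G a` the operator is the identity, which is compatible if it fixes `F a`, and on
the other ones it is composed with the projection of `G a` onto `F a`. In this way
`PushoutTower.Saturated.exists_projection` produces a norm one projection onto the subspace generated
by a `1`-complemented subspace of `X` and the spaces `G s`, `s ∈ S`, provided that each `F s` with
`s ∈ S` lies in the subspace generated by the earlier ones.

If `X` has an `ω`-skeleton `(X_γ)`, every index `s` belongs to a countable set which is saturated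
together with some `X_γ` (`exists_countable_saturated`). Under the continuum hypothesis there are at
most `ℵ₁` indices, so they can be ranked by countable ordinals with countably many of each bounded
rank. The subspaces generated by `X_δ` and the saturated sets of the indices of rank less than `δ`
form an `ω`-skeleton of `𝒦_{ω₁}(X)` (`PushoutTower.hasOmegaSkeleton`); the continuity of this chain is
clear, since unions of saturated sets are saturated.

If `X` has a skeleton, its identity is approximated on finite sets by contractive projections of
finite rank. This property, with norms close to one (`ApproxOn`), passes to closures and to unions of
chains, hence to limit stages. It passes to successor stages as well: a perturbation
(`ApproxOn.exists_fixing`) makes the operator exact on the finitely many spaces `F a` which matter for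
given finitely many vectors of `V (succ j)`, and it is then extended by the identity on the
corresponding `G a` (`PushoutTower.approxOn_succ`). So `𝒦_{ω₁}(X)` has the `1`-bounded approximation
property.
-/

namespace ComplDisp

/-! ### Bounded operators on subspaces and their extensions -/

section Glue

variable {E : Type u} [NormedAddCommGroup E] [NormedSpace ℝ E]
  {Z : Type v} [NormedAddCommGroup Z] [NormedSpace ℝ Z]

/-- A partially defined linear map has norm at most `C` on its domain. -/
def BoundedOn (C : ℝ) (f : E →ₗ.[ℝ] Z) : Prop :=
  ∀ x : f.domain, ‖f x‖ ≤ C * ‖(x : E)‖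

theorem pmap_apply_of_le {f g : E →ₗ.[ℝ] Z} (h : f ≤ g) (x : E) (hx : x ∈ f.domain) :
    f ⟨x, hx⟩ = g ⟨x, h.1 hx⟩ :=
  h.2 (x := ⟨x, hx⟩) (y := ⟨x, h.1 hx⟩) rfl

/-- A bounded operator into a Banach space extends to the closure of its domain. -/
theorem BoundedOn.exists_extend_closure [CompleteSpace Z] {C : ℝ} {f : E →ₗ.[ℝ] Z}
    (hf : BoundedOn C f) :
    ∃ g : E →ₗ.[ℝ] Z, g.domain = f.domain.topologicalClosure ∧ f ≤ g ∧ BoundedOn C g := by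
  have hle := f.domain.le_topologicalClosure
  let e : f.domain →ₗ[ℝ] f.domain.topologicalClosure := Submodule.inclusion hle
  have hdense : DenseRange e := by
    intro x
    rw [closure_subtype]
    have hx : (x : E) ∈ closure (f.domain : Set E) := x.2
    refine closure_mono ?_ hx
    intro y hy
    exact ⟨e ⟨y, hy⟩, ⟨⟨y, hy⟩, rfl⟩, rfl⟩
  have hbound : ∃ D, ∀ x, ‖f.toFun x‖ ≤ D * ‖e x‖ := ⟨C, fun x => hf x⟩
  let T := LinearMap.extendOfNorm f.toFun e
  have hT : ∀ x, T (e x) = f x := fun x =>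
    LinearMap.extendOfNorm_eq hdense hbound x
  refine ⟨⟨f.domain.topologicalClosure, T.toLinearMap⟩, rfl, ⟨hle, ?_⟩, ?_⟩
  · intro x y hxy
    have : y = e x := Subtype.ext hxy.symm
    subst this
    exact (hT x).symm
  · intro x
    change ‖T x‖ ≤ C * ‖x‖
    refine hdense.induction_on (p := fun x => ‖T x‖ ≤ C * ‖x‖) x
      (isClosed_le (by fun_prop) (by fun_prop)) fun y => ?_
    rw [hT]
    exact hf y

/-- A directed family of uniformly bounded operators into a Banach space has a common extension
to the closure of the union of the domains. -/
theorem exists_glue [CompleteSpace Z] {C : ℝ} {c : Set (E →ₗ.[ℝ] Z)} (hne : c.Nonempty)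
    (hc : DirectedOn (· ≤ ·) c) (hC : ∀ f ∈ c, BoundedOn C f) :
    ∃ g : E →ₗ.[ℝ] Z, (∀ x, x ∈ g.domain ↔ x ∈ closure (⋃ f ∈ c, (f.domain : Set E))) ∧
      (∀ f ∈ c, f ≤ g) ∧ BoundedOn C g := by
  have hb : BoundedOn C (LinearPMap.sSup c hc) := by
    rintro ⟨x, hx⟩
    obtain ⟨f, hf, hxf⟩ := (LinearPMap.mem_domain_sSup_iff hne hc).1 hx
    have h := pmap_apply_of_le (LinearPMap.le_sSup hc hf) x hxf
    rw [← h]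
    exact hC f hf ⟨x, hxf⟩
  obtain ⟨g, hg, hle, hbg⟩ := hb.exists_extend_closure
  refine ⟨g, fun x => ?_, fun f hf => (LinearPMap.le_sSup hc hf).trans hle, hbg⟩
  rw [hg, ← SetLike.mem_coe, Submodule.topologicalClosure_coe]
  have : ((LinearPMap.sSup c hc).domain : Set E) = ⋃ f ∈ c, (f.domain : Set E) := by
    ext y
    simp only [SetLike.mem_coe, LinearPMap.mem_domain_sSup_iff hne hc, Set.mem_iUnion, exists_prop]
  rw [this]

/-- If a bounded operator with closed domain is defined and agrees with `T` on a subspace, so it is and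
does on the closure of that subspace. -/
theorem BoundedOn.eqOn_topologicalClosure {C : ℝ} {f : E →ₗ.[ℝ] Z} (hf : BoundedOn C f)
    (hcl : IsClosed (f.domain : Set E)) (T : E →L[ℝ] Z) {S : Submodule ℝ E}
    (hS : ∀ x ∈ S, ∃ hx : x ∈ f.domain, f ⟨x, hx⟩ = T x) :
    ∀ x ∈ S.topologicalClosure, ∃ hx : x ∈ f.domain, f ⟨x, hx⟩ = T x := by
  have hcont : Continuous f.toFun := by
    exact (f.toFun.mkContinuous C hf).continuous
  have hc : IsClosed {x : f.domain | f.toFun x = T x} :=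
    isClosed_eq hcont (by fun_prop)
  have hc' := (hcl.isClosedEmbedding_subtypeVal).isClosedMap _ hc
  intro x hx
  have hsub : (S : Set E) ⊆ Subtype.val '' {x : f.domain | f.toFun x = T x} := by
    intro y hy
    obtain ⟨h1, h2⟩ := hS y hy
    exact ⟨⟨y, h1⟩, h2, rfl⟩
  obtain ⟨y, hy, rfl⟩ := closure_minimal hsub hc' hx
  exact ⟨y.2, hy⟩

end Glue

section Recursion

/-- Construction by transfinite recursion with choices: if every coherent family of admissible
values below `j` can be continued at `j`, then there is a coherent family of admissible values. -/
theorem exists_coherent {J : Type*} [LinearOrder J] [WellFoundedLT J] {α : Type*} [Nonempty α]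
    (P : J → α → Prop) (R : α → α → Prop)
    (H : ∀ (j : J) (f : J → α), (∀ i < j, P i (f i)) → (∀ k < j, ∀ i < k, R (f i) (f k)) →
      ∃ a, P j a ∧ ∀ i < j, R (f i) a) :
    ∃ f : J → α, ∀ j, P j (f j) ∧ ∀ i < j, R (f i) (f j) := by
  classical
  let step : ∀ j : J, (∀ i, i < j → α) → α := fun j g =>
    if h : ∃ a, P j a ∧ ∀ i (hi : i < j), R (g i hi) a then h.choose else Classical.arbitrary α
  let f : J → α := WellFoundedLT.fix step
  have hf : ∀ j, f j = step j fun i _ => f i := fun j => WellFoundedLT.fix_eq step j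
  refine ⟨f, fun j => ?_⟩
  induction j using WellFoundedLT.induction with
  | ind j ih =>
    have hex : ∃ a, P j a ∧ ∀ i (_ : i < j), R (f i) a :=
      H j f (fun i hi => (ih i hi).1) (fun k hk => (ih k hk).2)
    rw [hf j]
    simp only [step, dif_pos hex]
    exact hex.choose_spec

/-- Transfinite extension of bounded operators along a continuous chain of closed subspaces. If
an operator on `V ⊥` is given and operators on `V j` can be extended to `V (succ j)`, with the
same bound and preserving a property `P` inherited at limits, then there is a coherent family of
operators on all the `V j`. -/
theorem exists_transfinite_extension {J : Type*} [LinearOrder J] [WellFoundedLT J] [SuccOrder J]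
    [NoMaxOrder J]
    {E : Type u} [NormedAddCommGroup E] [NormedSpace ℝ E]
    {Z : Type v} [NormedAddCommGroup Z] [NormedSpace ℝ Z] [CompleteSpace Z]
    (V : J → Submodule ℝ E)
    (hlim : ∀ j, Order.IsSuccLimit j → (V j : Set E) = closure (⋃ i < j, (V i : Set E)))
    (C : ℝ) (P : J → (E →ₗ.[ℝ] Z) → Prop)
    (hmin : ∀ j, IsMin j → ∃ f : E →ₗ.[ℝ] Z, f.domain = V j ∧ BoundedOn C f ∧ P j f)
    (hsucc : ∀ j, ∀ f : E →ₗ.[ℝ] Z, f.domain = V j → BoundedOn C f → P j f →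
      ∃ g : E →ₗ.[ℝ] Z, g.domain = V (Order.succ j) ∧ BoundedOn C g ∧ P (Order.succ j) g ∧ f ≤ g)
    (hP : ∀ j, Order.IsSuccLimit j → ∀ g : E →ₗ.[ℝ] Z, g.domain = V j →
      (∀ i < j, ∃ f ≤ g, f.domain = V i ∧ P i f) → P j g) :
    ∃ f : J → (E →ₗ.[ℝ] Z), Monotone f ∧
      ∀ j, (f j).domain = V j ∧ BoundedOn C (f j) ∧ P j (f j) := by
  obtain ⟨f, hf⟩ := exists_coherent
    (fun j f => f.domain = V j ∧ BoundedOn C f ∧ P j f) (fun f g : E →ₗ.[ℝ] Z => f ≤ g) (by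
      intro j f hf hmono
      rcases Order.isMin_or_mem_range_succ_or_isSuccLimit j with hj | ⟨k, rfl⟩ | hj
      · obtain ⟨g, hg⟩ := hmin j hj
        exact ⟨g, hg, fun i hi => absurd hi hj.not_lt⟩
      · have hlt : k < Order.succ k := Order.lt_succ k
        obtain ⟨g, h1, h2, h3, h4⟩ := hsucc k (f k) (hf k hlt).1 (hf k hlt).2.1 (hf k hlt).2.2
        refine ⟨g, ⟨h1, h2, h3⟩, fun i hi => ?_⟩
        rcases (Order.lt_succ_iff.1 hi) |>.lt_or_eq with h | rfl
        · exact (hmono k hlt i h).trans h4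
        · exact h4
      · obtain ⟨i₀, hi₀⟩ : ∃ i, i < j := not_isMin_iff.1 hj.not_isMin
        have hmono' : ∀ i < j, ∀ k < j, i ≤ k → f i ≤ f k := by
          intro i hi k hk hik
          rcases hik.lt_or_eq with h | rfl
          · exact hmono k hk i h
          · exact le_rfl
        obtain ⟨g, hg, hfg, hgb⟩ := exists_glue (C := C) (c := f '' Set.Iio j)
          ⟨_, i₀, hi₀, rfl⟩
          (by
            rintro _ ⟨i, hi, rfl⟩ _ ⟨k, hk, rfl⟩
            exact ⟨f (max i k), ⟨max i k, max_lt hi hk, rfl⟩,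
              hmono' i hi _ (max_lt hi hk) (le_max_left _ _),
              hmono' k hk _ (max_lt hi hk) (le_max_right _ _)⟩)
          (by
            rintro _ ⟨i, hi, rfl⟩
            exact (hf i hi).2.1)
        have hdom : g.domain = V j := by
          ext x
          rw [hg, ← SetLike.mem_coe, hlim j hj, Set.biUnion_image]
          have : (⋃ i ∈ Set.Iio j, ((f i).domain : Set E)) = ⋃ i < j, (V i : Set E) := by
            refine Set.iUnion₂_congr fun i hi => ?_
            rw [(hf i hi).1]
          rw [this]
        refine ⟨g, ⟨hdom, hgb, hP j hj g hdom fun i hi => ?_⟩, fun i hi => hfg _ ⟨i, hi, rfl⟩⟩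
        exact ⟨f i, hfg _ ⟨i, hi, rfl⟩, (hf i hi).1, (hf i hi).2.2⟩)
  refine ⟨f, fun i j hij => ?_, fun j => (hf j).1⟩
  rcases hij.lt_or_eq with h | rfl
  · exact (hf j).2 i h
  · exact le_rfl

end Recursion

/-! ### The universal property of the push-out step -/

section Step

variable {P : Type u} [NormedAddCommGroup P] [NormedSpace ℝ P] [CompleteSpace P]

open scoped Classical in
/-- The canonical map of a summand `G_u` of the `ℓ₁`-sum into the push-out. -/
noncomputable def stepInl (a : ArrowIndex P) : a.G.Space →ₗ[ℝ] Step P :=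
  (pushoutDelta (stepTop P).toContinuousLinearMap (stepLeft P)).topologicalClosure.mkQ ∘ₗ
    (WithLp.linearEquiv 1 ℝ (lp (fun a : ArrowIndex P => a.G.Space) 1 × P)).symm.toLinearMap ∘ₗ
      LinearMap.inl ℝ _ P ∘ₗ lp.lsingle (𝕜 := ℝ) (E := fun a : ArrowIndex P => a.G.Space) 1 a

open scoped Classical in
theorem stepInl_apply (a : ArrowIndex P) (z : a.G.Space) :
    stepInl a z = Submodule.Quotient.mk (WithLp.toLp 1
      (lp.single (E := fun a : ArrowIndex P => a.G.Space) 1 a z, (0 : P))) := rfl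

theorem toStep_apply (x : P) :
    toStep P x = Submodule.Quotient.mk (WithLp.toLp 1
      ((0 : lp (fun a : ArrowIndex P => a.G.Space) 1), x)) := rfl

theorem norm_stepInl_le (a : ArrowIndex P) (z : a.G.Space) : ‖stepInl a z‖ ≤ ‖z‖ := by
  classical
  rw [stepInl_apply]
  refine (Submodule.Quotient.norm_mk_le _ _).trans (le_of_eq ?_)
  rw [WithLp.prod_norm_eq_of_L1]
  simp [lp.norm_single]

theorem stepInl_emb (a : ArrowIndex P) (y : a.F.Space) :
    stepInl a (a.u.emb y) = toStep P (a.d y) := by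
  classical
  rw [stepInl_apply, toStep_apply, Submodule.Quotient.eq]
  refine Submodule.le_topologicalClosure _
    ⟨lp.single (E := fun a : ArrowIndex P => a.F.Space) 1 a y, ?_⟩
  have h1 : stepTop P (lp.single (E := fun a : ArrowIndex P => a.F.Space) 1 a y) =
      lp.single (E := fun a : ArrowIndex P => a.G.Space) 1 a (a.u.emb y) := by
    ext b
    rcases eq_or_ne b a with rfl | hb
    · simp [stepTop]
    · simp [stepTop, hb]
  have h2 : stepLeft P (lp.single (E := fun a : ArrowIndex P => a.F.Space) 1 a y) = a.d y := by
    rw [stepLeft, ellOneSum_apply, tsum_eq_single a]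
    · simp
    · intro b hb
      simp [hb]
  change WithLp.toLp 1 (stepTop P _, - stepLeft P _) = _
  rw [h1, h2, ← WithLp.toLp_sub]
  simp

/-- `P_{α+1}` is generated by `P_α` and the finite-dimensional spaces `G_u`. -/
theorem step_generated (x : Step P) :
    x ∈ (LinearMap.range (toStep P).toLinearMap ⊔
      ⨆ a, LinearMap.range (stepInl (P := P) a)).topologicalClosure := by
  classical
  set S := (LinearMap.range (toStep P).toLinearMap ⊔ ⨆ a, LinearMap.range (stepInl (P := P) a))
  obtain ⟨⟨f, p⟩, rfl⟩ := Submodule.Quotient.mk_surjective _ x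
  let q : WithLp 1 (lp (fun a : ArrowIndex P => a.G.Space) 1 × P) → Step P :=
    Submodule.Quotient.mk
  let A : lp (fun a : ArrowIndex P => a.G.Space) 1 →+ Step P :=
    { toFun := fun f => q (WithLp.toLp 1 (f, (0 : P)))
      map_zero' := rfl
      map_add' := fun f g => by
        change q _ = q (_ + _)
        congr 1
        rw [← WithLp.toLp_add]
        simp }
  have hA : Continuous A := by
    have h1 : Continuous q := continuous_quot_mk
    refine h1.comp ?_
    fun_prop
  have hsum := (lp.hasSum_single (by simp : (1 : ℝ≥0∞) ≠ ⊤) f).map A hA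
  have h1 : A f ∈ S.topologicalClosure := by
    refine S.isClosed_topologicalClosure.mem_of_tendsto hsum (Filter.Eventually.of_forall ?_)
    intro s
    refine Submodule.sum_mem _ fun a _ => Submodule.le_topologicalClosure _ ?_
    refine le_sup_right (α := Submodule ℝ (Step P)) (Submodule.mem_iSup_of_mem a ⟨f a, ?_⟩)
    exact stepInl_apply a (f a)
  have h2 : toStep P p ∈ S.topologicalClosure :=
    Submodule.le_topologicalClosure _ (le_sup_left (α := Submodule ℝ (Step P)) ⟨p, rfl⟩)
  have h3 : A f + toStep P p = Submodule.Quotient.mk (WithLp.toLp 1 (f, p)) := by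
    rw [toStep_apply]
    change q (_ + _) = q _
    congr 1
    rw [← WithLp.toLp_add]
    simp
  rw [← h3]
  exact add_mem h1 h2

/-- The universal property of the push-out: a bounded operator on `P_α` extends to `P_{α+1}`, with
values prescribed on the spaces `G_u` compatibly with its values on the spaces `F_u`. -/
theorem step_extend {Z : Type v} [NormedAddCommGroup Z] [NormedSpace ℝ Z] [CompleteSpace Z]
    {C : ℝ} (T : P →ₗ[ℝ] Z) (hT : ∀ x, ‖T x‖ ≤ C * ‖x‖)
    (h : ∀ a : ArrowIndex P, a.G.Space →ₗ[ℝ] Z) (hh : ∀ a z, ‖h a z‖ ≤ C * ‖z‖)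
    (hc : ∀ a y, h a (a.u.emb y) = T (a.d y)) :
    ∃ T' : Step P →ₗ[ℝ] Z, (∀ x, ‖T' x‖ ≤ C * ‖x‖) ∧ (∀ x, T' (toStep P x) = T x) ∧
      ∀ a z, T' (stepInl a z) = h a z := by
  classical
  have hs : ∀ f : lp (fun a : ArrowIndex P => a.G.Space) 1, Summable fun a => C * ‖f a‖ :=
    fun f => (ellOne_summable_norm f).mul_left C
  have hs' : ∀ f : lp (fun a : ArrowIndex P => a.G.Space) 1, Summable fun a => h a (f a) :=
    fun f => Summable.of_norm_bounded (hs f) fun a => hh a (f a)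
  let Φ : WithLp 1 (lp (fun a : ArrowIndex P => a.G.Space) 1 × P) →ₗ[ℝ] Z :=
    { toFun := fun m => ∑' a, h a (m.fst a) + T m.snd
      map_add' := fun m n => by
        have := (hs' m.fst).tsum_add (hs' n.fst)
        simp only [WithLp.add_fst, WithLp.add_snd, lp.coeFn_add, Pi.add_apply, map_add, this]
        abel
      map_smul' := fun c m => by
        have := (hs' m.fst).tsum_const_smul c
        simp only [WithLp.smul_fst, WithLp.smul_snd, lp.coeFn_smul, Pi.smul_apply, map_smul, this,
          RingHom.id_apply, smul_add] }
  have hΦ : ∀ m, ‖Φ m‖ ≤ C * ‖m‖ := by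
    intro m
    rw [WithLp.prod_norm_eq_of_L1, mul_add]
    refine (norm_add_le _ _).trans (add_le_add ?_ (hT _))
    rw [ellOne_norm_eq, ← tsum_mul_left]
    exact tsum_of_norm_bounded (hs m.fst).hasSum fun a => hh a _
  have hΦc : Continuous Φ := (Φ.mkContinuous C hΦ).continuous
  set Δ := pushoutDelta (stepTop P).toContinuousLinearMap (stepLeft P)
  have hker : Δ.topologicalClosure ≤ LinearMap.ker Φ := by
    refine Submodule.topologicalClosure_minimal _ ?_ (isClosed_singleton.preimage hΦc)
    rintro _ ⟨f, rfl⟩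
    rw [LinearMap.mem_ker]
    change ∑' a : ArrowIndex P, h a (a.u.emb (f a)) + T (-(∑' a : ArrowIndex P, a.d (f a))) = 0
    have h1 : Continuous T := (T.mkContinuous C hT).continuous
    rw [map_neg, (ellOneSum_summable (fun a : ArrowIndex P => a.d) f).map_tsum T h1]
    simp [hc]
  refine ⟨Δ.topologicalClosure.liftQ Φ hker, fun x => ?_, fun x => ?_, fun a z => ?_⟩
  · rcases le_or_gt 0 C with hC | hC
    · refine le_of_forall_pos_le_add fun ε hε => ?_
      obtain ⟨m, rfl, hm⟩ := Submodule.Quotient.norm_mk_lt x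
        (show 0 < ε / (C + 1) by positivity)
      refine (hΦ m).trans ?_
      calc C * ‖m‖ ≤ C * (‖(Submodule.Quotient.mk m : Step P)‖ + ε / (C + 1)) := by gcongr
        _ = C * ‖(Submodule.Quotient.mk m : Step P)‖ + ε * (C / (C + 1)) := by ring
        _ ≤ _ := by
          have : C / (C + 1) ≤ 1 := by
            rw [div_le_one (by linarith)]
            linarith
          nlinarith
    · -- a negative bound forces `P_α ⊕₁ ℓ₁(G_u)` to be zero
      obtain ⟨m, rfl⟩ := Submodule.Quotient.mk_surjective _ x
      have : m = 0 := by
        rw [← norm_le_zero_iff]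
        have := (norm_nonneg _).trans (hΦ m)
        by_contra! hm
        nlinarith
      subst this
      simp
  · rw [toStep_apply]
    change ∑' a, h a ((0 : lp (fun a : ArrowIndex P => a.G.Space) 1) a) + T x = T x
    simp
  · rw [stepInl_apply]
    change ∑' b, h b (lp.single (E := fun a : ArrowIndex P => a.G.Space) 1 a z b) + T 0 = h a z
    rw [tsum_eq_single a]
    · simp
    · intro b hb
      simp [hb]

end Step

/-! ### Cardinalities -/

section Cardinality

open Cardinal

theorem mk_le_continuum_of_injective {α : Type u} {β : Type v} {f : α → β}
    (hf : Function.Injective f) (hβ : #β ≤ 𝔠) : #α ≤ 𝔠 := by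
  have h := lift_mk_le_lift_mk_of_injective hf
  rw [← lift_le_continuum.{u, v}]
  exact h.trans (lift_le_continuum.2 hβ)

theorem mk_le_continuum_iff {α : Type u} : #α ≤ 𝔠 ↔ ∃ f : α → Set ℕ, Function.Injective f := by
  refine ⟨fun h => ?_, fun ⟨f, hf⟩ => mk_le_continuum_of_injective hf mk_set_nat.le⟩
  have h' : lift.{0} #α ≤ lift.{u} #(Set ℕ) := by
    rw [mk_set_nat, lift_continuum, lift_uzero]
    exact h
  obtain ⟨f⟩ := lift_mk_le'.1 h'
  exact ⟨f, f.injective⟩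

theorem mk_countable_arrow_le {β : Type v} [Countable β] {α : Type u} (h : #α ≤ 𝔠) :
    #(β → α) ≤ 𝔠 := by
  obtain ⟨f, hf⟩ := mk_le_continuum_iff.1 h
  obtain ⟨e, he⟩ := exists_injective_nat β
  refine mk_le_continuum_iff.2 ⟨fun g => {n | ∃ b, ∃ m ∈ f (g b), n = Nat.pair (e b) m},
    fun g₁ g₂ hg => ?_⟩
  have key : ∀ g : β → α, ∀ b m, Nat.pair (e b) m ∈
      {n | ∃ b, ∃ m ∈ f (g b), n = Nat.pair (e b) m} ↔ m ∈ f (g b) := by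
    intro g b m
    refine ⟨?_, fun hm => ⟨b, m, hm, rfl⟩⟩
    rintro ⟨b', m', hm', heq⟩
    obtain ⟨h1, rfl⟩ := Nat.pair_eq_pair.1 heq
    rwa [he h1]
  funext b
  apply hf
  ext m
  rw [← key g₁, ← key g₂]
  exact Set.ext_iff.1 hg _

theorem mk_prod_le_continuum {α : Type u} {β : Type v} (hα : #α ≤ 𝔠) (hβ : #β ≤ 𝔠) :
    #(α × β) ≤ 𝔠 := by
  rw [mk_prod, ← continuum_mul_self]
  exact mul_le_mul' (lift_le_continuum.2 hα) (lift_le_continuum.2 hβ)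

theorem mk_sigma_le_continuum {α : Type u} {β : α → Type v} (hα : #α ≤ 𝔠)
    (hβ : ∀ a, #(β a) ≤ 𝔠) : #(Σ a, β a) ≤ 𝔠 := by
  choose f hf using fun a => mk_le_continuum_iff.1 (hβ a)
  refine mk_le_continuum_of_injective (f := fun x : Σ a, β a => (x.1, f x.1 x.2)) ?_
    (mk_prod_le_continuum hα mk_set_nat.le)
  rintro ⟨a, x⟩ ⟨b, y⟩ h
  obtain ⟨rfl, h⟩ := Prod.mk.inj h
  exact congrArg (Sigma.mk a) (hf a h)

theorem mk_iUnion_le_continuum {E : Type u} {ι : Type v} (hι : #ι ≤ 𝔠) {s : ι → Set E}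
    (hs : ∀ i, #(s i) ≤ 𝔠) : #(⋃ i, s i) ≤ 𝔠 := by
  have hsub : ∀ x : ⋃ i, s i, ∃ i, (x : E) ∈ s i := fun x => Set.mem_iUnion.1 x.2
  choose c hc using hsub
  refine mk_le_continuum_of_injective (f := fun x : ⋃ i, s i => (⟨c x, x, hc x⟩ : Σ i, s i)) ?_
    (mk_sigma_le_continuum hι hs)
  intro x y h
  have := congrArg (fun z : Σ i, s i => (z.2 : E)) h
  exact Subtype.ext this

theorem mk_closure_le {E : Type u} [TopologicalSpace E] [FirstCountableTopology E] [T2Space E]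
    {s : Set E} (hs : #s ≤ 𝔠) : #(closure s) ≤ 𝔠 := by
  have h : ∀ x : closure s, ∃ w : ℕ → s, Filter.Tendsto (fun n => (w n : E)) Filter.atTop
      (nhds (x : E)) := by
    intro x
    obtain ⟨w, hw, hx⟩ := mem_closure_iff_seq_limit.1 x.2
    exact ⟨fun n => ⟨w n, hw n⟩, hx⟩
  choose w hw using h
  refine mk_le_continuum_of_injective (f := w) (fun x y hxy => ?_) (mk_countable_arrow_le hs)
  have := hw y
  rw [← hxy] at this
  exact Subtype.ext (tendsto_nhds_unique (hw x) this)

theorem mk_span_le {E : Type u} [AddCommGroup E] [Module ℝ E] {s : Set E} (hs : #s ≤ 𝔠) :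
    #(Submodule.span ℝ s) ≤ 𝔠 := by
  have h : ∀ x : Submodule.span ℝ s, ∃ l : s →₀ ℝ,
      Finsupp.linearCombination ℝ (fun y : s => (y : E)) l = x := by
    intro x
    have := x.2
    rwa [Finsupp.mem_span_iff_linearCombination] at this
  choose l hl using h
  refine mk_le_continuum_of_injective
    (f := fun x k => ((l x).graph.toList)[k]?) (fun x y hxy => ?_)
    (mk_countable_arrow_le (β := ℕ) (α := Option (s × ℝ)) ?_)
  · have h1 : (l x).graph.toList = (l y).graph.toList := List.ext_getElem? fun k => congrFun hxy k
    have h2 : (l x).graph = (l y).graph := by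
      rw [← Finset.val_inj, ← Finset.coe_toList, h1, Finset.coe_toList]
    have h3 := Finsupp.graph_injective _ _ h2
    exact Subtype.ext (by rw [← hl x, h3, hl y])
  · rw [mk_option]
    have := mk_prod_le_continuum hs (mk_real.le : #ℝ ≤ 𝔠)
    calc _ ≤ 𝔠 + 1 := by gcongr
      _ = 𝔠 := by exact_mod_cast continuum_add_nat 1

instance (F : FinDimSpace) : FiniteDimensional ℝ F.Space :=
  inferInstanceAs (FiniteDimensional ℝ (Fin F.dim → ℝ))

theorem FinDimSpace.continuous_norm (F : FinDimSpace) : Continuous F.norm := by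
  let e : (Fin F.dim → ℝ) →ₗ[ℝ] F.Space := LinearMap.id (R := ℝ) (M := Fin F.dim → ℝ)
  have he : Continuous e := e.continuous_of_finiteDimensional
  exact he.norm

theorem mk_finDimSpace_le : #FinDimSpace ≤ 𝔠 := by
  refine mk_le_continuum_of_injective (β := ℕ × (ℕ → ℝ))
    (f := fun F => (F.dim, fun k => F.norm (TopologicalSpace.denseSeq (Fin F.dim → ℝ) k))) ?_
    (mk_prod_le_continuum (mk_nat.le.trans aleph0_le_continuum)
      (mk_countable_arrow_le mk_real.le))
  intro F G h
  have hF := F.continuous_norm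
  have hG := G.continuous_norm
  obtain ⟨n, N, hN⟩ := F
  obtain ⟨m, M, hM⟩ := G
  obtain ⟨rfl, h⟩ := Prod.mk.inj h
  have : (N : (Fin n → ℝ) → ℝ) = M :=
    (TopologicalSpace.denseRange_denseSeq _).equalizer hF hG h
  obtain rfl := DFunLike.coe_injective this
  rfl

theorem mk_linearMap_le (F : FinDimSpace) {E : Type u} [AddCommGroup E] [Module ℝ E]
    (hE : #E ≤ 𝔠) : #(F.Space →ₗ[ℝ] E) ≤ 𝔠 := by
  refine mk_le_continuum_of_injective
    (f := fun (T : F.Space →ₗ[ℝ] E) (i : Fin F.dim) => T (Pi.basisFun ℝ (Fin F.dim) i)) ?_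
    (mk_countable_arrow_le hE)
  intro S T h
  exact (Pi.basisFun ℝ (Fin F.dim)).ext (f₁ := S) (f₂ := T) fun i => congrFun h i

theorem FinDimSpace.mk_space_le (F : FinDimSpace) : #F.Space ≤ 𝔠 :=
  mk_countable_arrow_le (β := Fin F.dim) mk_real.le

theorem mk_arrowIndex_le {P : Type u} [NormedAddCommGroup P] [NormedSpace ℝ P] (hP : #P ≤ 𝔠) :
    #(ArrowIndex P) ≤ 𝔠 := by
  refine mk_le_continuum_of_injective (β := Σ F : FinDimSpace, Σ G : FinDimSpace,
      (F.Space →ₗ[ℝ] G.Space) × (G.Space →ₗ[ℝ] F.Space) × (F.Space →ₗ[ℝ] P))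
    (f := fun a => ⟨a.F, a.G, a.u.emb.toLinearMap, a.u.proj.toLinearMap, a.d.toLinearMap⟩) ?_
    (mk_sigma_le_continuum mk_finDimSpace_le fun F =>
      mk_sigma_le_continuum mk_finDimSpace_le fun G =>
        mk_prod_le_continuum (mk_linearMap_le F G.mk_space_le)
          (mk_prod_le_continuum (mk_linearMap_le G F.mk_space_le) (mk_linearMap_le F hP)))
  rintro ⟨F, G, ⟨e, p, hp, hpe⟩, d, hd⟩ ⟨F', G', ⟨e', p', hp', hpe'⟩, d', hd'⟩ h
  obtain ⟨rfl, h⟩ := Sigma.mk.inj h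
  obtain ⟨rfl, h⟩ := Sigma.mk.inj (eq_of_heq h)
  simp only [heq_eq_eq, Prod.mk.injEq] at h
  obtain ⟨h1, h2, h3⟩ := h
  obtain rfl := LinearIsometry.toLinearMap_injective h1
  obtain rfl := ContinuousLinearMap.coe_injective h2
  obtain rfl := LinearIsometry.toLinearMap_injective h3
  rfl

end Cardinality

/-! ### Towers of push-outs inside a Banach space -/

/-- A space `K` exhausted by a continuous increasing chain `V` of closed subspaces, starting with an
isometric copy of `X`, in which `V (succ j)` is obtained from `V j` by attaching finite-dimensional
spaces `G a` along the first components `F a → G a` of double arrows `u a`. The map `glue a` is the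
canonical contraction of `G a` into `V (succ j)`; its composition with `F a → G a` takes values in
`V j` and is the operator along which `G a` is attached. The field `extend` is the universal property
of the push-out, for operators bounded by `C`, and `mk_I_le` bounds the number of spaces attached. -/
structure PushoutTower (J : Type) [LinearOrder J] [SuccOrder J] [OrderBot J]
    (X K : Type u) [NormedAddCommGroup X] [NormedSpace ℝ X] [NormedAddCommGroup K]
    [NormedSpace ℝ K] where
  V : J → Submodule ℝ K
  isClosed_V : ∀ j, IsClosed (V j : Set K)
  mono : Monotone V
  base : X →ₗᵢ[ℝ] K
  range_base : LinearMap.range base.toLinearMap = V ⊥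
  I : J → Type u
  F : ∀ {j}, I j → FinDimSpace
  G : ∀ {j}, I j → FinDimSpace
  u : ∀ {j} (a : I j), DoubleArrow (F a).Space (G a).Space
  glue : ∀ {j} (a : I j), (G a).Space →ₗ[ℝ] K
  norm_glue_le : ∀ {j} (a : I j) z, ‖glue a z‖ ≤ ‖z‖
  glue_mem : ∀ {j} (a : I j) z, glue a z ∈ V (Order.succ j)
  glue_emb_mem : ∀ {j} (a : I j) y, glue a ((u a).emb y) ∈ V j
  succ_le : ∀ j, V (Order.succ j) ≤ (V j ⊔ ⨆ a : I j, LinearMap.range (glue a)).topologicalClosure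
  limit : ∀ j, Order.IsSuccLimit j → (V j : Set K) = closure (⋃ i < j, (V i : Set K))
  total : ∀ x : K, x ∈ closure (⋃ j, (V j : Set K))
  extend : ∀ (j : J) {Z : Type u} [NormedAddCommGroup Z] [NormedSpace ℝ Z] [CompleteSpace Z]
    {C : ℝ} (f : K →ₗ.[ℝ] Z), f.domain = V j → BoundedOn C f →
    ∀ h : ∀ a : I j, (G a).Space →ₗ[ℝ] Z, (∀ a z, ‖h a z‖ ≤ C * ‖z‖) →
    (∀ a y (hy : glue a ((u a).emb y) ∈ f.domain), h a ((u a).emb y) = f ⟨_, hy⟩) →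
    ∃ f' : K →ₗ.[ℝ] Z, f'.domain = V (Order.succ j) ∧ BoundedOn C f' ∧ f ≤ f' ∧
      ∀ a z (hz : glue a z ∈ f'.domain), f' ⟨_, hz⟩ = h a z
  mk_I_le : ∀ j, #(V j) ≤ 𝔠 → #(I j) ≤ 𝔠

namespace Ban

/-- The members of a chain of Banach spaces exhaust its colimit. -/
theorem mem_closure_of_isColimit {J : Type} [LinearOrder J] [Nonempty J] {D : J ⥤ Ban.{u}}
    {s : Cocone D} (hs : IsColimit s) (x : s.pt) :
    x ∈ closure (⋃ j, Set.range (iso (s.ι.app j))) := by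
  let e := (limitIsColimit D).coconePointUniqueUpToIso hs
  have he : ∀ j y, iso e.hom (iso ((limitCocone D).ι.app j) y) = iso (s.ι.app j) y := by
    intro j y
    rw [← iso_comp]
    exact congrArg (fun f => iso f y)
      ((limitIsColimit D).comp_coconePointUniqueUpToIso_hom hs j)
  have hx : x = iso e.hom (iso e.inv x) := by
    rw [← iso_comp, e.inv_hom_id]
    rfl
  rw [hx]
  generalize iso e.inv x = y
  change UniformSpace.Completion (Union D) at y
  induction y using UniformSpace.Completion.induction_on with
  | hp => exact isClosed_closure.preimage (iso e.hom).continuous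
  | ih a =>
    induction a using DirectLimit.induction with
    | ih i y =>
      refine subset_closure (Set.mem_iUnion.2 ⟨i, y, ?_⟩)
      rw [← he]
      rfl

end Ban

section Extraction

variable (X : Type u) [NormedAddCommGroup X] [NormedSpace ℝ X] [CompleteSpace X]

theorem noMaxOrder_countableOrdinals : NoMaxOrder CountableOrdinals := by
  have : Order.IsSuccPrelimit (Ordinal.type fun x y : CountableOrdinals => x < y) := by
    rw [Ordinal.type_toType]
    exact (Cardinal.isSuccLimit_omega 1).isSuccPrelimit
  exact Ordinal.isSuccPrelimit_type_lt_iff.1 this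

/-- The stage `P_α` of the construction of `𝒦_{ω₁}(X)`. -/
noncomputable abbrev stage (j : CountableOrdinals) : Ban.{u} :=
  ((succStruct X).iterationFunctor CountableOrdinals).obj j

/-- The into isometry `P_α → 𝒦_{ω₁}(X)`. -/
noncomputable def stageIncl (j : CountableOrdinals) : stage X j →ₗᵢ[ℝ] KOmegaOne X :=
  Ban.iso (((succStruct X).iterationCocone CountableOrdinals).ι.app j)

/-- The into isometry `P_α → P_β`. -/
noncomputable def stageMap {i j : CountableOrdinals} (h : i ≤ j) : stage X i →ₗᵢ[ℝ] stage X j :=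
  Ban.iso (((succStruct X).iterationFunctor CountableOrdinals).map (homOfLE h))

theorem stageIncl_stageMap {i j : CountableOrdinals} (h : i ≤ j) (x : stage X i) :
    stageIncl X j (stageMap X h x) = stageIncl X i x :=
  congrArg (fun f => Ban.iso f x)
    (((succStruct X).iterationCocone CountableOrdinals).w (homOfLE h))

theorem exists_stageSucc (j : CountableOrdinals) :
    ∃ e : Step (stage X j) ≃ₗᵢ[ℝ] stage X (Order.succ j),
      ∀ x, e (toStep (stage X j) x) = stageMap X (Order.le_succ j) x := by
  have := noMaxOrder_countableOrdinals
  let e := (succStruct X).iterationFunctorObjSuccIso j (not_isMax j)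
  have h1 : ∀ x, Ban.iso e.inv (Ban.iso e.hom x) = x := fun x => by
    rw [← Ban.iso_comp, e.hom_inv_id]; rfl
  refine ⟨LinearIsometryEquiv.ofSurjective (Ban.iso e.inv) fun x => ⟨_, h1 x⟩, fun x => ?_⟩
  exact (congrArg (fun f => Ban.iso f x)
    ((succStruct X).iterationFunctor_map_succ j (not_isMax j))).symm

theorem nonempty_stageBot : Nonempty (X ≃ₗᵢ[ℝ] stage X ⊥) := by
  let e := (succStruct X).iterationFunctorObjBotIso CountableOrdinals
  have h1 : ∀ x, Ban.iso e.inv (Ban.iso e.hom x) = x := fun x => by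
    rw [← Ban.iso_comp, e.hom_inv_id]; rfl
  exact ⟨LinearIsometryEquiv.ofSurjective (Ban.iso e.inv) fun x => ⟨_, h1 x⟩⟩

theorem stage_limit (j : CountableOrdinals) (hj : Order.IsSuccLimit j) (x : stage X j) :
    x ∈ closure (⋃ i : Set.Iio j, Set.range (stageMap X i.2.le)) := by
  have : Nonempty (Set.Iio j) := ⟨⟨⊥, hj.bot_lt⟩⟩
  exact Ban.mem_closure_of_isColimit
    (((succStruct X).iterationFunctor CountableOrdinals).isColimitOfIsWellOrderContinuous j hj) x

theorem stage_total (x : KOmegaOne X) : x ∈ closure (⋃ j, Set.range (stageIncl X j)) :=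
  Ban.mem_closure_of_isColimit ((succStruct X).isColimitIterationCocone CountableOrdinals) x

theorem stageIncl_mem_range {i j : CountableOrdinals} (h : i ≤ j) (x : stage X i) :
    stageIncl X i x ∈ LinearMap.range (stageIncl X j).toLinearMap :=
  ⟨stageMap X h x, stageIncl_stageMap X h x⟩

/-- The tower of the images in `𝒦_{ω₁}(X)` of the stages of its construction. -/
noncomputable def kTower : PushoutTower CountableOrdinals X (KOmegaOne X) where
  V j := LinearMap.range (stageIncl X j).toLinearMap
  isClosed_V j := (stageIncl X j).isometry.isClosedEmbedding.isClosed_range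
  mono i j h := by
    rintro _ ⟨x, rfl⟩
    exact stageIncl_mem_range X h x
  base := (stageIncl X ⊥).comp (nonempty_stageBot X).some.toLinearIsometry
  range_base := by
    ext y
    constructor
    · rintro ⟨x, rfl⟩
      exact ⟨_, rfl⟩
    · rintro ⟨x, rfl⟩
      refine ⟨(nonempty_stageBot X).some.symm x, ?_⟩
      change stageIncl X ⊥ ((nonempty_stageBot X).some ((nonempty_stageBot X).some.symm x)) = _
      rw [LinearIsometryEquiv.apply_symm_apply]
      rfl
  I j := ArrowIndex (stage X j)
  F a := a.F
  G a := a.G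
  u a := a.u
  glue {j} a := (stageIncl X (Order.succ j)).toLinearMap ∘ₗ
    (exists_stageSucc X j).choose.toLinearIsometry.toLinearMap ∘ₗ stepInl a
  norm_glue_le {j} a z := by
    change ‖stageIncl X (Order.succ j) ((exists_stageSucc X j).choose (stepInl a z))‖ ≤ _
    rw [LinearIsometry.norm_map, LinearIsometryEquiv.norm_map]
    exact norm_stepInl_le a z
  glue_mem a z := ⟨_, rfl⟩
  glue_emb_mem {j} a y := by
    refine ⟨a.d y, ?_⟩
    change _ = stageIncl X (Order.succ j) ((exists_stageSucc X j).choose (stepInl a (a.u.emb y)))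
    rw [stepInl_emb, (exists_stageSucc X j).choose_spec, stageIncl_stageMap]
    rfl
  succ_le j := by
    rintro _ ⟨x, rfl⟩
    set e := (exists_stageSucc X j).choose with he
    have hx := step_generated (e.symm x)
    let A : Step (stage X j) →ₗᵢ[ℝ] KOmegaOne X :=
      (stageIncl X (Order.succ j)).comp e.toLinearIsometry
    have hA : A (e.symm x) = stageIncl X (Order.succ j) x := by
      change stageIncl X (Order.succ j) (e (e.symm x)) = _
      rw [LinearIsometryEquiv.apply_symm_apply]
    change stageIncl X (Order.succ j) x ∈ _
    rw [← hA]
    refine map_mem_closure A.continuous hx ?_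
    have key : ((LinearMap.range (toStep (stage X j)).toLinearMap ⊔
        ⨆ a, LinearMap.range (stepInl (P := stage X j) a))).map A.toLinearMap ≤
        LinearMap.range (stageIncl X j).toLinearMap ⊔ ⨆ a : ArrowIndex (stage X j),
          LinearMap.range ((stageIncl X (Order.succ j)).toLinearMap ∘ₗ
            e.toLinearIsometry.toLinearMap ∘ₗ stepInl a) := by
      rw [Submodule.map_sup, Submodule.map_iSup]
      refine sup_le_sup ?_ (iSup_mono fun a => ?_)
      · rintro _ ⟨_, ⟨y, rfl⟩, rfl⟩
        refine ⟨y, ?_⟩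
        change _ = stageIncl X (Order.succ j) (e (toStep (stage X j) y))
        rw [(exists_stageSucc X j).choose_spec, stageIncl_stageMap]
        rfl
      · rintro _ ⟨_, ⟨y, rfl⟩, rfl⟩
        exact ⟨y, rfl⟩
    exact fun y hy => key ⟨y, hy, rfl⟩
  limit j hj := by
    have hcl : IsClosed (LinearMap.range (stageIncl X j).toLinearMap : Set (KOmegaOne X)) :=
      (stageIncl X j).isometry.isClosedEmbedding.isClosed_range
    refine Set.Subset.antisymm ?_ (closure_minimal (Set.iUnion₂_subset fun i hi => ?_) hcl)
    · rintro _ ⟨x, rfl⟩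
      refine map_mem_closure (stageIncl X j).continuous (stage_limit X j hj x) ?_
      rintro _ hy
      obtain ⟨i, y, rfl⟩ := Set.mem_iUnion.1 hy
      exact Set.mem_iUnion₂.2 ⟨i, i.2, y, (stageIncl_stageMap X _ y).symm⟩
    · rintro _ ⟨x, rfl⟩
      exact stageIncl_mem_range X hi.le x
  total x := stage_total X x
  extend j Z _ _ _ C f hf hC h hh hc := by
    set e := (exists_stageSucc X j).choose
    have hmem : ∀ x, (stageIncl X j).toLinearMap x ∈ f.domain := fun x => by
      rw [hf]
      exact ⟨x, rfl⟩
    have heq : ∀ {x y : KOmegaOne X} (hxy : x = y) (hx : x ∈ f.domain) (hy : y ∈ f.domain),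
        f ⟨x, hx⟩ = f ⟨y, hy⟩ := by
      rintro x _ rfl _ _
      rfl
    have hd : ∀ (a : ArrowIndex (stage X j)) y,
        stageIncl X (Order.succ j) (e (stepInl a (a.u.emb y))) = stageIncl X j (a.d y) := by
      intro a y
      rw [stepInl_emb, (exists_stageSucc X j).choose_spec, stageIncl_stageMap]
    obtain ⟨T, hTb, hT1, hT2⟩ := step_extend (C := C)
      (f.toFun ∘ₗ (stageIncl X j).toLinearMap.codRestrict f.domain hmem)
      (fun x => by
        refine (hC _).trans_eq ?_
        congr 1
        exact (stageIncl X j).norm_map x) h hh (fun a y => by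
        rw [hc a y ((hd a y).symm ▸ hmem (a.d y))]
        exact heq (hd a y) _ _)
    let r := (stageIncl X (Order.succ j)).equivRange
    have hr : ∀ y (hy : stageIncl X (Order.succ j) y ∈
        LinearMap.range (stageIncl X (Order.succ j)).toLinearMap), r.symm ⟨_, hy⟩ = y := by
      intro y hy
      rw [LinearIsometryEquiv.symm_apply_eq]
      rfl
    let f' : KOmegaOne X →ₗ.[ℝ] Z :=
      ⟨LinearMap.range (stageIncl X (Order.succ j)).toLinearMap,
        T ∘ₗ e.symm.toLinearIsometry.toLinearMap ∘ₗ r.symm.toLinearIsometry.toLinearMap⟩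
    have hf' : ∀ y hy, f' ⟨stageIncl X (Order.succ j) (e y), hy⟩ = T y := by
      intro y hy
      change T (e.symm (r.symm _)) = _
      rw [hr, LinearIsometryEquiv.symm_apply_apply]
    refine ⟨f', rfl, fun x => ?_, ⟨?_, ?_⟩, fun a z hz => ?_⟩
    · refine (hTb _).trans_eq ?_
      congr 1
      change ‖e.symm (r.symm x)‖ = _
      rw [LinearIsometryEquiv.norm_map, LinearIsometryEquiv.norm_map]
      rfl
    · rw [hf]
      rintro _ ⟨x, rfl⟩
      exact stageIncl_mem_range X (Order.le_succ j) x
    · rintro ⟨x, hx⟩ ⟨y, hy⟩ (rfl : x = y)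
      have hx' := hx
      rw [hf] at hx'
      obtain ⟨w, rfl⟩ := hx'
      have h1 : (stageIncl X j).toLinearMap w =
          stageIncl X (Order.succ j) (e (toStep (stage X j) w)) := by
        rw [(exists_stageSucc X j).choose_spec, stageIncl_stageMap]
        rfl
      have h2 : f' ⟨(stageIncl X j).toLinearMap w, hy⟩ = T (toStep (stage X j) w) := by
        rw [← hf' _ (h1 ▸ hy)]
        congr 1
        exact Subtype.ext h1
      rw [h2, hT1]
      rfl
    · rw [← hT2]
      exact hf' _ hz
  mk_I_le j h := by
    refine mk_arrowIndex_le (mk_le_continuum_of_injective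
      (f := (stageIncl X j).equivRange) (stageIncl X j).equivRange.injective h)

end Extraction

/-! ### Complemented subspaces of a tower -/

namespace PushoutTower

variable {J : Type} [LinearOrder J] [SuccOrder J] [OrderBot J] [WellFoundedLT J] [NoMaxOrder J]
  {X K : Type u} [NormedAddCommGroup X] [NormedSpace ℝ X] [NormedAddCommGroup K] [NormedSpace ℝ K]
  (T : PushoutTower J X K)

/-- The closed subspace of `K` generated by a subspace `A` of `X` and the spaces `G s`, `s ∈ S`. -/
def gen (A : Submodule ℝ X) (S : Set (Σ j, T.I j)) : Submodule ℝ K :=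
  (A.map T.base.toLinearMap ⊔ ⨆ s ∈ S, LinearMap.range (T.glue s.2)).topologicalClosure

/-- The indices of the push-outs performed before stage `j`. -/
def below (j : J) : Set (Σ j, T.I j) := {s | s.1 < j}

/-- The pair `(A, S)` is saturated if the attaching subspace of every `s ∈ S` is contained in the
subspace generated by `A` and the earlier elements of `S`. -/
def Saturated (A : Submodule ℝ X) (S : Set (Σ j, T.I j)) : Prop :=
  ∀ s ∈ S, ∀ y, T.glue s.2 ((T.u s.2).emb y) ∈ T.gen A (S ∩ T.below s.1)

variable {T}

theorem isClosed_gen (A : Submodule ℝ X) (S : Set (Σ j, T.I j)) :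
    IsClosed (T.gen A S : Set K) :=
  Submodule.isClosed_topologicalClosure _

theorem base_mem_gen {A : Submodule ℝ X} (S : Set (Σ j, T.I j)) {x : X} (hx : x ∈ A) :
    T.base x ∈ T.gen A S :=
  Submodule.le_topologicalClosure _
    (le_sup_left (α := Submodule ℝ K) (Submodule.mem_map_of_mem hx))

theorem glue_mem_gen (A : Submodule ℝ X) {S : Set (Σ j, T.I j)} {s : Σ j, T.I j} (hs : s ∈ S)
    (z : (T.G s.2).Space) : T.glue s.2 z ∈ T.gen A S :=
  Submodule.le_topologicalClosure _ (le_sup_right (α := Submodule ℝ K)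
    (Submodule.mem_iSup_of_mem s (Submodule.mem_iSup_of_mem hs ⟨z, rfl⟩)))

theorem gen_le {A : Submodule ℝ X} {S : Set (Σ j, T.I j)} {M : Submodule ℝ K}
    (hM : IsClosed (M : Set K)) (hA : ∀ x ∈ A, T.base x ∈ M)
    (hS : ∀ s ∈ S, ∀ z, T.glue s.2 z ∈ M) : T.gen A S ≤ M := by
  refine Submodule.topologicalClosure_minimal _ (sup_le ?_ (iSup₂_le ?_)) hM
  · rintro _ ⟨x, hx, rfl⟩
    exact hA x hx
  · rintro s hs _ ⟨z, rfl⟩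
    exact hS s hs z

theorem gen_mono {A B : Submodule ℝ X} {S S' : Set (Σ j, T.I j)} (hAB : A ≤ B) (hS : S ⊆ S') :
    T.gen A S ≤ T.gen B S' :=
  gen_le (isClosed_gen _ _) (fun _ hx => base_mem_gen _ (hAB hx))
    fun _ hs z => glue_mem_gen _ (hS hs) z

theorem base_mem (x : X) (j : J) : T.base x ∈ T.V j := by
  refine T.mono bot_le ?_
  rw [← T.range_base]
  exact ⟨x, rfl⟩

theorem gen_below_le (A : Submodule ℝ X) (j : J) : T.gen A (T.below j) ≤ T.V j :=
  gen_le (T.isClosed_V j) (fun x _ => base_mem x j)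
    fun s hs z => T.mono (Order.succ_le_of_lt hs) (T.glue_mem s.2 z)

/-- Every stage of the tower is contained in any closed subspace which contains `X` and the spaces
attached before that stage. -/
theorem V_le_of_mem {M : Submodule ℝ K} (hM : IsClosed (M : Set K)) (hX : ∀ x, T.base x ∈ M)
    {j : J} (hS : ∀ s : Σ j, T.I j, s.1 < j → ∀ z, T.glue s.2 z ∈ M) : T.V j ≤ M := by
  induction j using WellFoundedLT.induction with
  | ind j ih =>
    rcases Order.isMin_or_mem_range_succ_or_isSuccLimit j with hj | ⟨k, rfl⟩ | hj
    · rw [hj.eq_bot, ← T.range_base]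
      rintro _ ⟨x, rfl⟩
      exact hX x
    · refine (T.succ_le k).trans (Submodule.topologicalClosure_minimal _ (sup_le ?_ ?_) hM)
      · exact ih k (Order.lt_succ k) fun s hs z => hS s (hs.trans (Order.lt_succ k)) z
      · refine iSup_le fun a => ?_
        rintro _ ⟨z, rfl⟩
        exact hS ⟨k, a⟩ (Order.lt_succ k) z
    · rw [← SetLike.coe_subset_coe, T.limit j hj]
      exact closure_minimal (Set.iUnion₂_subset fun i hi =>
        ih i hi fun s hs z => hS s (hs.trans hi) z) hM

theorem V_eq_gen (j : J) : T.V j = T.gen ⊤ (T.below j) :=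
  le_antisymm (V_le_of_mem (isClosed_gen _ _) (fun _ => base_mem_gen _ Submodule.mem_top)
    fun _ hs z => glue_mem_gen _ hs z) (gen_below_le ⊤ j)

/-- A subspace generated by a saturated pair `(A, S)` in which `A` is `1`-complemented in `X` is
`1`-complemented in `K`. The projection is built by transfinite recursion: a space `G s` attached
along `F s` is fixed if `s ∈ S`, and is first projected to `F s` otherwise. -/
theorem Saturated.exists_projection [CompleteSpace K] {A : Submodule ℝ X} {S : Set (Σ j, T.I j)}
    (hS : T.Saturated A S) (p : X →ₗ[ℝ] X) (hp : ∀ x, ‖p x‖ ≤ ‖x‖) (hpA : ∀ x, p x ∈ A)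
    (hpx : ∀ x ∈ A, p x = x) :
    ∃ Q : K →L[ℝ] K, ‖Q‖ ≤ 1 ∧ (∀ x, Q x ∈ T.gen A S) ∧ ∀ x ∈ T.gen A S, Q x = x := by
  classical
  set W := T.gen A S with hW
  have hWc : CompleteSpace W := (isClosed_gen A S).completeSpace_coe
  obtain ⟨f, hmono, hf⟩ := exists_transfinite_extension (Z := W) T.V T.limit 1
    (fun j f => (∀ x ∈ A, ∀ h : T.base x ∈ f.domain, (f ⟨T.base x, h⟩ : K) = T.base x) ∧
      ∀ s ∈ S, s.1 < j → ∀ z, ∀ h : T.glue s.2 z ∈ f.domain, (f ⟨_, h⟩ : K) = T.glue s.2 z)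
    (by
      intro j hj
      obtain rfl := hj.eq_bot
      let r := T.base.equivRange
      have hr : ∀ x (h : T.base x ∈ LinearMap.range T.base.toLinearMap), r.symm ⟨_, h⟩ = x := by
        intro x h
        rw [LinearIsometryEquiv.symm_apply_eq]
        rfl
      let f : K →ₗ.[ℝ] W := ⟨LinearMap.range T.base.toLinearMap,
        ((T.base.toLinearMap ∘ₗ p).codRestrict W fun x => base_mem_gen S (hpA x)) ∘ₗ
          r.symm.toLinearIsometry.toLinearMap⟩
      have hfx : ∀ x h, (f ⟨T.base x, h⟩ : K) = T.base (p x) := by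
        intro x h
        change T.base (p (r.symm _)) = _
        rw [hr]
      refine ⟨f, T.range_base, ?_, fun x hx h => ?_, fun s _ hs => absurd hs not_lt_bot⟩
      · rintro ⟨_, x, rfl⟩
        refine (congrArg norm (hfx x ⟨x, rfl⟩)).trans_le ?_
        change ‖T.base (p x)‖ ≤ 1 * ‖T.base x‖
        rw [LinearIsometry.norm_map, LinearIsometry.norm_map, one_mul]
        exact hp x
      · rw [hfx, hpx x hx])
    (by
      rintro j f hdom hbd ⟨hfA, hfS⟩
      have hmem : ∀ (a : T.I j) y, T.glue a ((T.u a).emb y) ∈ f.domain := fun a y => by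
        rw [hdom]
        exact T.glue_emb_mem a y
      -- the operator fixes the part of `gen A S` generated before stage `j`
      have hfix : ∀ x ∈ T.gen A (S ∩ T.below j), ∃ hx : x ∈ f.domain, (f ⟨x, hx⟩ : K) = x := by
        have := BoundedOn.eqOn_topologicalClosure (f := W.subtype.compPMap f) (C := 1) hbd
          (by
            change IsClosed (f.domain : Set K)
            rw [hdom]
            exact T.isClosed_V j) (ContinuousLinearMap.id ℝ K)
          (S := A.map T.base.toLinearMap ⊔ ⨆ s ∈ S ∩ T.below j, LinearMap.range (T.glue s.2)) ?_
        · exact this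
        have hle : A.map T.base.toLinearMap ⊔
            ⨆ s ∈ S ∩ T.below j, LinearMap.range (T.glue s.2) ≤
              (W.subtype.compPMap f).eqLocus (LinearMap.id.toPMap ⊤) := by
          refine sup_le ?_ (iSup₂_le ?_)
          · rintro _ ⟨x, hx, rfl⟩
            have hd : T.base x ∈ f.domain := by
              rw [hdom]
              exact base_mem x j
            exact ⟨hd, trivial, hfA x hx hd⟩
          · rintro s ⟨hs, hsj⟩ _ ⟨z, rfl⟩
            have hd : T.glue s.2 z ∈ f.domain := by
              rw [hdom]
              exact T.mono (Order.succ_le_of_lt hsj) (T.glue_mem s.2 z)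
            exact ⟨hd, trivial, hfS s hs hsj z hd⟩
        intro x hx
        obtain ⟨h1, _, h2⟩ := hle hx
        exact ⟨h1, h2⟩
      let lf : ∀ a : T.I j, (T.F a).Space →ₗ[ℝ] W := fun a => f.toFun ∘ₗ
        (T.glue a ∘ₗ (T.u a).emb.toLinearMap).codRestrict f.domain (hmem a)
      let h : ∀ a : T.I j, (T.G a).Space →ₗ[ℝ] W := fun a =>
        if ha : (⟨j, a⟩ : Σ j, T.I j) ∈ S then
          (T.glue a).codRestrict W fun z => glue_mem_gen A ha z
        else lf a ∘ₗ (T.u a).proj.toLinearMap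
      obtain ⟨g, hg1, hg2, hg3, hg4⟩ := T.extend j (C := 1) f hdom hbd h
        (by
          intro a z
          by_cases ha : (⟨j, a⟩ : Σ j, T.I j) ∈ S
          · simp only [h, dif_pos ha, one_mul]
            exact T.norm_glue_le a z
          · simp only [h, dif_neg ha, one_mul]
            refine (hbd _).trans ?_
            rw [one_mul]
            refine (T.norm_glue_le a _).trans ?_
            change ‖(T.u a).emb ((T.u a).proj z)‖ ≤ ‖z‖
            rw [LinearIsometry.norm_map]
            exact (ContinuousLinearMap.le_of_opNorm_le _ (T.u a).norm_proj_le z).trans_eq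
              (one_mul _))
        (by
          intro a y hy
          by_cases ha : (⟨j, a⟩ : Σ j, T.I j) ∈ S
          · simp only [h, dif_pos ha]
            obtain ⟨_, h1⟩ := hfix _ (hS ⟨j, a⟩ ha y)
            exact Subtype.ext h1.symm
          · simp only [h, dif_neg ha]
            change lf a ((T.u a).proj ((T.u a).emb y)) = _
            rw [(T.u a).proj_emb]
            rfl)
      refine ⟨g, hg1, hg2, ⟨fun x hx hd => ?_, fun s hs hsj z hd => ?_⟩, hg3⟩
      · have hd' : T.base x ∈ f.domain := by
          rw [hdom]
          exact base_mem x j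
        rw [← pmap_apply_of_le hg3 _ hd']
        exact hfA x hx hd'
      · rcases (Order.lt_succ_iff.1 hsj).lt_or_eq with hlt | heq
        · have hd' : T.glue s.2 z ∈ f.domain := by
            rw [hdom]
            exact T.mono (Order.succ_le_of_lt hlt) (T.glue_mem s.2 z)
          rw [← pmap_apply_of_le hg3 _ hd']
          exact hfS s hs hlt z hd'
        · obtain ⟨i, a⟩ := s
          obtain rfl : i = j := heq
          rw [hg4 a z hd]
          simp only [h, dif_pos hs]
          rfl)
    (by
      intro j hj g hg hi
      refine ⟨fun x hx hd => ?_, fun s hs hsj z hd => ?_⟩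
      · obtain ⟨f, hfg, hdom, hf, -⟩ := hi ⊥ hj.bot_lt
        have hd' : T.base x ∈ f.domain := by
          rw [hdom]
          exact base_mem x ⊥
        rw [← pmap_apply_of_le hfg _ hd']
        exact hf x hx hd'
      · obtain ⟨f, hfg, hdom, -, hf⟩ := hi (Order.succ s.1) (hj.succ_lt hsj)
        have hd' : T.glue s.2 z ∈ f.domain := by
          rw [hdom]
          exact T.glue_mem s.2 z
        rw [← pmap_apply_of_le hfg _ hd']
        exact hf s hs (Order.lt_succ _) z hd')
  obtain ⟨g, hg, hfg, hgb⟩ := exists_glue (C := 1) (c := Set.range f) ⟨_, ⊥, rfl⟩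
    (by
      rintro _ ⟨i, rfl⟩ _ ⟨k, rfl⟩
      exact ⟨_, ⟨max i k, rfl⟩, hmono (le_max_left _ _), hmono (le_max_right _ _)⟩)
    (by
      rintro _ ⟨i, rfl⟩
      exact (hf i).2.1)
  have hdom : ∀ x, x ∈ g.domain := by
    intro x
    rw [hg, Set.biUnion_range]
    have : (⋃ i, ((f i).domain : Set K)) = ⋃ i, (T.V i : Set K) :=
      Set.iUnion_congr fun i => by rw [(hf i).1]
    rw [this]
    exact T.total x
  let Q₀ : K →ₗ[ℝ] K := W.subtype ∘ₗ g.toFun ∘ₗ LinearMap.id.codRestrict g.domain hdom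
  let Q : K →L[ℝ] K := Q₀.mkContinuous 1 fun x => hgb ⟨x, hdom x⟩
  have hQ : ∀ x, Q x = g ⟨x, hdom x⟩ := fun x => rfl
  refine ⟨Q, LinearMap.mkContinuous_norm_le _ zero_le_one _, fun x => ?_, ?_⟩
  · rw [hQ]
    exact Subtype.coe_prop _
  · have hle : T.gen A S ≤ LinearMap.eqLocus Q₀ LinearMap.id := by
      refine gen_le (isClosed_eq Q.continuous continuous_id) (fun x hx => ?_) fun s hs z => ?_
      · have hd : T.base x ∈ (f ⊥).domain := by
          rw [(hf ⊥).1]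
          exact base_mem x ⊥
        change Q (T.base x) = T.base x
        rw [hQ, ← pmap_apply_of_le (hfg _ ⟨⊥, rfl⟩) _ hd]
        exact (hf ⊥).2.2.1 x hx hd
      · have hd : T.glue s.2 z ∈ (f (Order.succ s.1)).domain := by
          rw [(hf _).1]
          exact T.glue_mem s.2 z
        change Q (T.glue s.2 z) = T.glue s.2 z
        rw [hQ, ← pmap_apply_of_le (hfg _ ⟨_, rfl⟩) _ hd]
        exact (hf _).2.2.2 s hs (Order.lt_succ _) z hd
    exact fun x hx => hle hx

/-- Every stage is `1`-complemented in the whole space. -/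
theorem exists_projection_V [CompleteSpace K] (j : J) :
    ∃ Q : K →L[ℝ] K, ‖Q‖ ≤ 1 ∧ (∀ x, Q x ∈ T.V j) ∧ ∀ x ∈ T.V j, Q x = x := by
  rw [V_eq_gen]
  refine Saturated.exists_projection (fun s hs y => ?_) LinearMap.id (fun _ => le_rfl)
    (fun _ => Submodule.mem_top) fun _ _ => rfl
  have h := T.glue_emb_mem s.2 y
  rw [V_eq_gen] at h
  exact gen_mono le_rfl (fun t (ht : t.1 < s.1) => Set.mem_inter (lt_trans ht hs : t.1 < j) ht) h

end PushoutTower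

/-! ### Projections along a chain of complemented subspaces -/

section Chain

variable {X : Type u} [NormedAddCommGroup X] [NormedSpace ℝ X]

/-- There is a contractive operator from `B` to `A` which is the identity on `A ⊓ B`; for `A ≤ B`, a
contractive projection of `B` onto `A`. -/
def IsComplementedIn (A B : Submodule ℝ X) : Prop :=
  ∃ q : B →ₗ[ℝ] A, (∀ x, ‖q x‖ ≤ ‖x‖) ∧ ∀ (x : A) (h : (x : X) ∈ B), q ⟨x, h⟩ = x

theorem IsComplementedIn.refl (A : Submodule ℝ X) : IsComplementedIn A A :=
  ⟨LinearMap.id, fun _ => le_rfl, fun _ _ => rfl⟩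

theorem isComplementedIn_of_doubleArrow {A B : Submodule ℝ X}
    (h : ∃ δ : DoubleArrow A B, ∀ x : A, (δ.emb x : X) = x) : IsComplementedIn A B := by
  obtain ⟨δ, hδ⟩ := h
  refine ⟨δ.proj.toLinearMap, fun x => ?_, fun x hx => ?_⟩
  · exact (ContinuousLinearMap.le_of_opNorm_le _ δ.norm_proj_le x).trans_eq (one_mul _)
  · have : (⟨x, hx⟩ : B) = δ.emb x := Subtype.ext (hδ x).symm
    rw [this]
    exact δ.proj_emb x

/-- In a continuous chain of subspaces with dense union, in which every member is contractively
complemented in the next one, the first member is contractively complemented in the whole space: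
the projections of the successive members are composed, and glued at limits. -/
theorem exists_projection_of_chain {J : Type*} [LinearOrder J] [WellFoundedLT J] [SuccOrder J]
    [NoMaxOrder J] [OrderBot J] (V : J → Submodule ℝ X) [CompleteSpace (V ⊥)] (hV : Monotone V)
    (hlim : ∀ j, Order.IsSuccLimit j → (V j : Set X) = closure (⋃ i < j, (V i : Set X)))
    (hsucc : ∀ j, IsComplementedIn (V j) (V (Order.succ j)))
    (htotal : ∀ x, x ∈ closure (⋃ j, (V j : Set X))) :
    ∃ p : X →ₗ[ℝ] X, (∀ x, ‖p x‖ ≤ ‖x‖) ∧ (∀ x, p x ∈ V ⊥) ∧ ∀ x ∈ V ⊥, p x = x := by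
  let f₀ : X →ₗ.[ℝ] V ⊥ := ⟨V ⊥, LinearMap.id⟩
  obtain ⟨f, hmono, hf⟩ := exists_transfinite_extension V hlim 1 (fun _ f => f₀ ≤ f)
    (by
      intro j hj
      obtain rfl := hj.eq_bot
      exact ⟨f₀, rfl, fun x => (one_mul ‖(x : X)‖).ge, le_rfl⟩)
    (by
      intro j f hdom hb hf₀
      obtain ⟨q, hq1, hq2⟩ := hsucc j
      let g : X →ₗ.[ℝ] V ⊥ :=
        ⟨V (Order.succ j), f.toFun ∘ₗ Submodule.inclusion hdom.ge ∘ₗ q⟩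
      have hfg : f ≤ g := by
        refine ⟨hdom.le.trans (hV (Order.le_succ j)), ?_⟩
        rintro ⟨x, hx⟩ ⟨y, hy⟩ (rfl : x = y)
        have hx' := hx
        rw [hdom] at hx'
        change _ = f (Submodule.inclusion hdom.ge (q ⟨x, hy⟩))
        rw [hq2 ⟨x, hx'⟩ hy]
        rfl
      refine ⟨g, rfl, fun x => ?_, hf₀.trans hfg, hfg⟩
      refine (hb _).trans ?_
      rw [one_mul, one_mul]
      exact hq1 x)
    (by
      intro j hj g hg hi
      obtain ⟨f, hfg, -, hf⟩ := hi ⊥ hj.bot_lt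
      exact hf.trans hfg)
  obtain ⟨g, hg, hfg, hgb⟩ := exists_glue (C := 1) (c := Set.range f) ⟨_, ⊥, rfl⟩
    (by
      rintro _ ⟨i, rfl⟩ _ ⟨k, rfl⟩
      exact ⟨_, ⟨max i k, rfl⟩, hmono (le_max_left _ _), hmono (le_max_right _ _)⟩)
    (by
      rintro _ ⟨i, rfl⟩
      exact (hf i).2.1)
  have hdom : ∀ x, x ∈ g.domain := by
    intro x
    rw [hg, Set.biUnion_range]
    have : (⋃ i, ((f i).domain : Set X)) = ⋃ i, (V i : Set X) :=
      Set.iUnion_congr fun i => by rw [(hf i).1]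
    rw [this]
    exact htotal x
  refine ⟨(V ⊥).subtype ∘ₗ g.toFun ∘ₗ LinearMap.id.codRestrict g.domain hdom,
    fun x => (hgb ⟨x, hdom x⟩).trans_eq (one_mul _), fun x => Subtype.coe_prop _, fun x hx => ?_⟩
  have := pmap_apply_of_le ((hf ⊥).2.2.trans (hfg _ ⟨⊥, rfl⟩)) x hx
  exact congrArg Subtype.val this.symm

end Chain

/-! ### The metric approximation property -/

section Approx

variable {K : Type u} [NormedAddCommGroup K] [NormedSpace ℝ K]

/-- The identity of `K` can be approximated on finite subsets of `M` by operators of finite rank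
and of norm close to one. -/
def ApproxOn (M : Set K) : Prop :=
  ∀ s : Finset K, (s : Set K) ⊆ M → ∀ ε > 0, ∃ T : K →L[ℝ] K,
    FiniteDimensional ℝ T.range ∧ ‖T‖ ≤ 1 + ε ∧ ∀ x ∈ s, ‖T x - x‖ ≤ ε

theorem ApproxOn.mono {M N : Set K} (hN : ApproxOn N) (h : M ⊆ N) : ApproxOn M :=
  fun s hs => hN s (hs.trans h)

theorem ApproxOn.closure {M : Set K} (hM : ApproxOn M) : ApproxOn (closure M) := by
  classical
  intro s hs ε hε
  obtain ⟨δ, hδ, hδ1, hδε⟩ : ∃ δ > 0, δ ≤ 1 ∧ 4 * δ ≤ ε :=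
    ⟨min 1 (ε / 4), by positivity, min_le_left _ _, by linarith [min_le_right 1 (ε / 4)]⟩
  have h : ∀ x : K, ∃ y, x ∈ s → y ∈ M ∧ ‖x - y‖ ≤ δ := by
    intro x
    by_cases hx : x ∈ s
    · obtain ⟨y, hy, hxy⟩ := Metric.mem_closure_iff.1 (hs hx) δ hδ
      exact ⟨y, fun _ => ⟨hy, by rw [← dist_eq_norm]; exact hxy.le⟩⟩
    · exact ⟨0, fun h => absurd h hx⟩
  choose y hy using h
  obtain ⟨T, hT1, hT2, hT3⟩ := hM (s.image y) (by
    intro z hz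
    obtain ⟨x, hx, rfl⟩ := Finset.mem_image.1 (Finset.mem_coe.1 hz)
    exact (hy x hx).1) δ hδ
  refine ⟨T, hT1, by linarith, fun x hx => ?_⟩
  have h1 := hT3 _ (Finset.mem_image_of_mem y hx)
  have h2 := (hy x hx).2
  have h3 : ‖T (x - y x)‖ ≤ (1 + δ) * δ :=
    (T.le_of_opNorm_le hT2 _).trans (by gcongr)
  have h4 : T x - x = T (x - y x) + (T (y x) - y x) - (x - y x) := by
    rw [map_sub]
    abel
  calc ‖T x - x‖ ≤ ‖T (x - y x)‖ + ‖T (y x) - y x‖ + ‖x - y x‖ := by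
        rw [h4]
        exact (norm_sub_le _ _).trans (add_le_add_left (norm_add_le _ _) _)
    _ ≤ (1 + δ) * δ + δ + δ := by gcongr
    _ ≤ ε := by nlinarith

/-- The approximation can be taken exact on a given finite-dimensional subspace `F`: the operator
`T` is replaced by `T + (1 - T) P`, where `P` is a bounded projection onto `F`. -/
theorem ApproxOn.exists_fixing {M : Set K} (hM : ApproxOn M) (F : Submodule ℝ K)
    [FiniteDimensional ℝ F] (hF : (F : Set K) ⊆ M) {ε : ℝ} (hε : 0 < ε) :
    ∃ T : K →L[ℝ] K, FiniteDimensional ℝ T.range ∧ ‖T‖ ≤ 1 + ε ∧ ∀ x ∈ F, T x = x := by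
  classical
  obtain ⟨P, hP⟩ := Submodule.ClosedComplemented.of_finiteDimensional F
  let b := Module.finBasis ℝ F
  let c : ∀ i, F →L[ℝ] ℝ := fun i => LinearMap.toContinuousLinearMap (b.coord i)
  set C := ∑ i, ‖c i‖ with hC
  have hC0 : 0 ≤ C := Finset.sum_nonneg fun i _ => norm_nonneg (c i)
  set η := ε / (1 + C * ‖P‖) with hη
  have hpos : 0 < 1 + C * ‖P‖ := by positivity
  have hη0 : 0 < η := by positivity
  obtain ⟨T, hT1, hT2, hT3⟩ := hM (Finset.univ.image fun i => (b i : K)) (by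
    intro z hz
    obtain ⟨i, -, rfl⟩ := Finset.mem_image.1 (Finset.mem_coe.1 hz)
    exact hF (b i).2) η hη0
  let A : F →L[ℝ] K := (ContinuousLinearMap.id ℝ K - T).comp F.subtypeL
  have hA : ‖A‖ ≤ C * η := by
    refine A.opNorm_le_bound (by positivity) fun x => ?_
    have hx : A x = ∑ i, c i x • A (b i) := by
      conv_lhs => rw [← b.sum_repr x]
      rw [map_sum]
      exact Finset.sum_congr rfl fun i _ => map_smul _ _ _
    rw [hx, hC, Finset.sum_mul, Finset.sum_mul]
    refine (norm_sum_le _ _).trans (Finset.sum_le_sum fun i _ => ?_)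
    rw [norm_smul]
    have h1 : ‖A (b i)‖ ≤ η := by
      have := hT3 _ (Finset.mem_image_of_mem (fun i => (b i : K)) (Finset.mem_univ i))
      rwa [norm_sub_rev] at this
    calc ‖c i x‖ * ‖A (b i)‖ ≤ (‖c i‖ * ‖x‖) * η :=
          mul_le_mul ((c i).le_opNorm x) h1 (norm_nonneg _) (by positivity)
      _ = ‖c i‖ * η * ‖x‖ := by ring
  refine ⟨T + A.comp P, ?_, ?_, fun x hx => ?_⟩
  · have hAr : FiniteDimensional ℝ (LinearMap.range A.toLinearMap) := inferInstance
    have hle : (T + A.comp P).range ≤ T.range ⊔ LinearMap.range A.toLinearMap := by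
      rintro _ ⟨x, rfl⟩
      exact Submodule.add_mem_sup ⟨x, rfl⟩ ⟨P x, rfl⟩
    exact Submodule.finiteDimensional_of_le hle
  · calc ‖T + A.comp P‖ ≤ ‖T‖ + ‖A‖ * ‖P‖ :=
          (norm_add_le _ _).trans (add_le_add_right (A.opNorm_comp_le P) _)
      _ ≤ (1 + η) + C * η * ‖P‖ := by gcongr
      _ = 1 + η * (1 + C * ‖P‖) := by ring
      _ = 1 + ε := by rw [hη, div_mul_cancel₀ _ hpos.ne']
  · have h1 : P x = ⟨x, hx⟩ := hP ⟨x, hx⟩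
    change T x + (((P x : F) : K) - T (P x : F)) = x
    rw [h1]
    abel

theorem ApproxOn.hasBAPWith (h : ApproxOn (Set.univ : Set K)) : HasBAPWith 1 K := by
  intro F hF lam hlam
  obtain ⟨T, h1, h2, h3⟩ := h.exists_fixing F (Set.subset_univ _) (sub_pos.2 hlam)
  exact ⟨T, h1, by linarith, h3⟩

/-- Approximability passes to unions of chains. -/
theorem ApproxOn.iUnion {ι : Type*} [LinearOrder ι] [Nonempty ι] {M : ι → Set K} (hM : Monotone M)
    (h : ∀ i, ApproxOn (M i)) : ApproxOn (⋃ i, M i) := by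
  intro s hs
  obtain ⟨i, hi⟩ := hM.directed_le.exists_mem_subset_of_finset_subset_biUnion hs
  exact h i s hi

end Approx

namespace PushoutTower

variable {J : Type} [LinearOrder J] [SuccOrder J] [OrderBot J] [WellFoundedLT J] [NoMaxOrder J]
  {X K : Type u} [NormedAddCommGroup X] [NormedSpace ℝ X] [NormedAddCommGroup K] [NormedSpace ℝ K]
  [CompleteSpace K] {T : PushoutTower J X K}

/-- Approximability passes from a stage to the next one. An operator `S` of finite rank which is
exact on the finite-dimensional data involved is extended to the next stage by the identity on the
finitely many relevant spaces `G a` and by `S` composed with the projection to `F a` on the other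
ones. -/
theorem approxOn_succ (j : J) (hj : ApproxOn (T.V j : Set K)) :
    ApproxOn (T.V (Order.succ j) : Set K) := by
  classical
  refine ApproxOn.mono (M := (T.V (Order.succ j) : Set K))
    (ApproxOn.closure (M := ((T.V j ⊔ ⨆ a : T.I j, LinearMap.range (T.glue a) :
      Submodule ℝ K) : Set K)) ?_) (T.succ_le j)
  intro s hs ε hε
  have hdec : ∀ x : K, ∃ (v w : K) (t : Finset (T.I j)), x ∈ s →
      v ∈ T.V j ∧ w ∈ ⨆ a ∈ t, LinearMap.range (T.glue a) ∧ v + w = x := by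
    intro x
    by_cases hx : x ∈ s
    · obtain ⟨v, hv, w, hw, rfl⟩ := Submodule.mem_sup.1 (hs hx)
      obtain ⟨t, ht⟩ := (Submodule.mem_iSup_iff_exists_finset).1 hw
      exact ⟨v, w, t, fun _ => ⟨hv, ht, rfl⟩⟩
    · exact ⟨0, 0, ∅, fun h => absurd h hx⟩
  choose v w t hvw using hdec
  let t' : Finset (T.I j) := s.biUnion t
  let F : Submodule ℝ K := Submodule.span ℝ (v '' s) ⊔
    ⨆ a : t', LinearMap.range (T.glue (a : T.I j) ∘ₗ (T.u (a : T.I j)).emb.toLinearMap)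
  have hFfin : FiniteDimensional ℝ F := by
    have : FiniteDimensional ℝ (Submodule.span ℝ (v '' s)) :=
      FiniteDimensional.span_of_finite ℝ (s.finite_toSet.image v)
    infer_instance
  have hFV : F ≤ T.V j := by
    refine sup_le (Submodule.span_le.2 ?_) (iSup_le fun a => ?_)
    · rintro _ ⟨x, hx, rfl⟩
      exact (hvw x hx).1
    · rintro _ ⟨y, rfl⟩
      exact T.glue_emb_mem _ y
  obtain ⟨S, hS1, hS2, hS3⟩ := hj.exists_fixing F hFV hε
  let R : Submodule ℝ K := S.range ⊔ ⨆ a : t', LinearMap.range (T.glue (a : T.I j))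
  have hRfin : FiniteDimensional ℝ R := inferInstance
  have hglueR : ∀ a ∈ t', ∀ z, T.glue a z ∈ R := fun a ha z =>
    le_sup_right (α := Submodule ℝ K) (Submodule.mem_iSup_of_mem (⟨a, ha⟩ : t') ⟨z, rfl⟩)
  let S' : K →ₗ[ℝ] R := S.toLinearMap.codRestrict R fun x =>
    le_sup_left (α := Submodule ℝ K) ⟨x, rfl⟩
  let f : K →ₗ.[ℝ] R := S'.toPMap (T.V j)
  have hSb : ∀ x, ‖S x‖ ≤ (1 + ε) * ‖x‖ := fun x => S.le_of_opNorm_le hS2 x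
  let h : ∀ a : T.I j, (T.G a).Space →ₗ[ℝ] R := fun a =>
    if ha : a ∈ t' then (T.glue a).codRestrict R (hglueR a ha)
    else S' ∘ₗ T.glue a ∘ₗ (T.u a).emb.toLinearMap ∘ₗ (T.u a).proj.toLinearMap
  obtain ⟨g, hg1, hg2, hg3, hg4⟩ := T.extend j (C := 1 + ε) f rfl (fun x => hSb x) h
    (by
      intro a z
      by_cases ha : a ∈ t'
      · simp only [h, dif_pos ha]
        refine (T.norm_glue_le a z).trans (le_mul_of_one_le_left (norm_nonneg _) ?_)
        linarith
      · simp only [h, dif_neg ha]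
        refine (hSb _).trans ?_
        gcongr
        refine (T.norm_glue_le a _).trans ?_
        change ‖(T.u a).emb ((T.u a).proj z)‖ ≤ ‖z‖
        rw [LinearIsometry.norm_map]
        exact (ContinuousLinearMap.le_of_opNorm_le _ (T.u a).norm_proj_le z).trans_eq
          (one_mul _))
    (by
      intro a y hy
      by_cases ha : a ∈ t'
      · simp only [h, dif_pos ha]
        refine Subtype.ext (hS3 _ ?_).symm
        exact le_sup_right (α := Submodule ℝ K)
          (Submodule.mem_iSup_of_mem (⟨a, ha⟩ : t') ⟨y, rfl⟩)
      · simp only [h, dif_neg ha]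
        change S' (T.glue a ((T.u a).emb ((T.u a).proj ((T.u a).emb y)))) = _
        rw [(T.u a).proj_emb]
        rfl)
  obtain ⟨Q, hQ1, hQ2, hQ3⟩ := exists_projection_V (T := T) (Order.succ j)
  have hQg : ∀ x, Q x ∈ g.domain := fun x => hg1 ▸ hQ2 x
  let U₀ : K →ₗ[ℝ] K := R.subtype ∘ₗ g.toFun ∘ₗ Q.toLinearMap.codRestrict g.domain hQg
  have hU : ∀ x, ‖U₀ x‖ ≤ (1 + ε) * ‖x‖ := by
    intro x
    refine (hg2 ⟨Q x, hQg x⟩).trans ?_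
    gcongr
    exact (Q.le_of_opNorm_le hQ1 x).trans_eq (one_mul _)
  have hfix : F ⊔ ⨆ a : t', LinearMap.range (T.glue (a : T.I j)) ≤
      (R.subtype.compPMap g).eqLocus (LinearMap.id.toPMap ⊤) := by
    refine sup_le (fun x hx => ?_) (iSup_le fun a => ?_)
    · have hd : x ∈ f.domain := hFV hx
      refine ⟨hg3.1 hd, trivial, ?_⟩
      change ((g ⟨x, _⟩ : R) : K) = x
      rw [← pmap_apply_of_le hg3 x hd]
      exact hS3 x hx
    · rintro _ ⟨z, rfl⟩
      have hd : T.glue a.1 z ∈ g.domain := by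
        rw [hg1]
        exact T.glue_mem _ z
      refine ⟨hd, trivial, ?_⟩
      change ((g ⟨_, _⟩ : R) : K) = T.glue a.1 z
      rw [hg4 a.1 z hd]
      simp only [h, dif_pos a.2]
      rfl
  refine ⟨U₀.mkContinuous (1 + ε) hU, ?_, LinearMap.mkContinuous_norm_le _ (by positivity) _,
    fun x hx => ?_⟩
  · have hle : LinearMap.range U₀ ≤ R := by
      rintro _ ⟨x, rfl⟩
      exact Subtype.coe_prop _
    exact Submodule.finiteDimensional_of_le hle
  · obtain ⟨hv, hw, hx'⟩ := hvw x hx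
    have hxm : x ∈ F ⊔ ⨆ a : t', LinearMap.range (T.glue (a : T.I j)) := by
      rw [← hx']
      refine Submodule.add_mem_sup (le_sup_left (α := Submodule ℝ K)
        (Submodule.subset_span ⟨x, hx, rfl⟩)) ?_
      have hle : (⨆ a ∈ t x, LinearMap.range (T.glue a)) ≤
          ⨆ a : t', LinearMap.range (T.glue (a : T.I j)) :=
        iSup₂_le fun a ha => le_iSup (fun a : t' => LinearMap.range (T.glue (a : T.I j)))
          ⟨a, Finset.mem_biUnion.2 ⟨x, hx, ha⟩⟩
      exact hle hw
    obtain ⟨hd, _, hgx⟩ := hfix hxm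
    have hQx : Q x = x := hQ3 x (hg1 ▸ hd)
    have heq : U₀ x = x := by
      have h1 : (⟨Q x, hQg x⟩ : g.domain) = ⟨x, hd⟩ := Subtype.ext hQx
      change ((g ⟨Q x, hQg x⟩ : R) : K) = x
      rw [h1]
      exact hgx
    change ‖U₀ x - x‖ ≤ ε
    rw [heq, sub_self, norm_zero]
    exact hε.le

theorem approxOn_V (h : ApproxOn (T.V ⊥ : Set K)) (j : J) : ApproxOn (T.V j : Set K) := by
  induction j using WellFoundedLT.induction with
  | ind j ih =>
    rcases Order.isMin_or_mem_range_succ_or_isSuccLimit j with hj | ⟨k, rfl⟩ | hj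
    · rwa [hj.eq_bot]
    · exact approxOn_succ k (ih k (Order.lt_succ k))
    · rw [T.limit j hj]
      have : Nonempty (Set.Iio j) := ⟨⟨⊥, hj.bot_lt⟩⟩
      have h1 := ApproxOn.iUnion (M := fun i : Set.Iio j => (T.V i : Set K))
        (fun a b hab => T.mono hab) fun i => ih i i.2
      refine ApproxOn.closure (h1.mono ?_)
      exact Set.iUnion₂_subset fun i hi => Set.subset_iUnion
        (fun i : Set.Iio j => (T.V i : Set K)) ⟨i, hi⟩

theorem approxOn_univ (h : ApproxOn (T.V ⊥ : Set K)) : ApproxOn (Set.univ : Set K) :=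
  (ApproxOn.iUnion (fun _ _ hij => T.mono hij) (approxOn_V h)).closure.mono fun x _ => T.total x

end PushoutTower

/-- A space with a skeleton is exhausted by `1`-complemented finite-dimensional subspaces. -/
theorem HasSkeleton.exists_projection {X : Type u} [NormedAddCommGroup X] [NormedSpace ℝ X]
    (hX : HasSkeleton X) : ∃ S : ℕ → Submodule ℝ X, Monotone S ∧
      (∀ x, x ∈ closure (⋃ n, (S n : Set X))) ∧ ∀ n, FiniteDimensional ℝ (S n) ∧
        ∃ p : X →ₗ[ℝ] X, (∀ x, ‖p x‖ ≤ ‖x‖) ∧ (∀ x, p x ∈ S n) ∧ ∀ x ∈ S n, p x = x := by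
  obtain ⟨S, hfin, hmono, hδ, hdense⟩ := hX
  refine ⟨S, hmono, fun x => hdense ▸ Set.mem_univ x, fun n => ⟨hfin n, ?_⟩⟩
  have hn := hfin n
  have : CompleteSpace (S (n + (⊥ : ℕ))) := FiniteDimensional.complete ℝ (S n)
  refine exists_projection_of_chain (fun m : ℕ => S (n + m))
    (fun a b hab => hmono (Nat.add_le_add_left hab n))
    (fun j hj => absurd hj Order.not_isSuccLimit_of_isSuccArchimedean)
    (fun j => isComplementedIn_of_doubleArrow (hδ (n + j))) fun x => ?_
  have hx : x ∈ closure (⋃ n, (S n : Set X)) := hdense ▸ Set.mem_univ x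
  refine closure_mono (Set.iUnion_subset fun m => ?_) hx
  exact (SetLike.coe_subset_coe.2 (hmono (Nat.le_add_left m n))).trans
    (Set.subset_iUnion (fun m => (S (n + m) : Set X)) m)

theorem PushoutTower.approxOn_bot {J : Type} [LinearOrder J] [SuccOrder J] [OrderBot J]
    [WellFoundedLT J] [NoMaxOrder J]
    {X K : Type u} [NormedAddCommGroup X] [NormedSpace ℝ X] [NormedAddCommGroup K]
    [NormedSpace ℝ K] [CompleteSpace K] (T : PushoutTower J X K) (hX : HasSkeleton X) :
    ApproxOn (T.V ⊥ : Set K) := by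
  obtain ⟨S, hmono, hdense, hS⟩ := hX.exists_projection
  obtain ⟨Q, hQ1, hQ2, hQ3⟩ := exists_projection_V (T := T) ⊥
  have h1 : ∀ n, ApproxOn (T.base '' S n) := by
    intro n s hs ε hε
    obtain ⟨hfin, p, hp1, hp2, hp3⟩ := hS n
    have hQr : ∀ x, Q.toLinearMap x ∈ LinearMap.range T.base.toLinearMap := fun x => by
      rw [T.range_base]
      exact hQ2 x
    let r := T.base.equivRange
    let U : K →ₗ[ℝ] K := T.base.toLinearMap ∘ₗ p ∘ₗ r.symm.toLinearIsometry.toLinearMap ∘ₗ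
      Q.toLinearMap.codRestrict _ hQr
    have hU : ∀ x, ‖U x‖ ≤ 1 * ‖x‖ := by
      intro x
      change ‖T.base (p (r.symm ⟨Q x, hQr x⟩))‖ ≤ 1 * ‖x‖
      rw [LinearIsometry.norm_map]
      refine (hp1 _).trans ?_
      rw [LinearIsometryEquiv.norm_map]
      exact Q.le_of_opNorm_le hQ1 x
    refine ⟨U.mkContinuous 1 hU, ?_,
      (LinearMap.mkContinuous_norm_le _ zero_le_one _).trans (by linarith), fun y hy => ?_⟩
    · have hle : LinearMap.range U ≤ (S n).map T.base.toLinearMap := by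
        rintro _ ⟨x, rfl⟩
        exact ⟨_, hp2 _, rfl⟩
      exact Submodule.finiteDimensional_of_le hle
    · obtain ⟨x, hx, rfl⟩ := hs hy
      have h2 : (⟨Q (T.base x), hQr _⟩ : LinearMap.range T.base.toLinearMap) = r x :=
        Subtype.ext (hQ3 _ (base_mem x ⊥))
      have h3 : U (T.base x) = T.base x := by
        change T.base (p (r.symm ⟨Q (T.base x), hQr _⟩)) = _
        rw [h2, LinearIsometryEquiv.symm_apply_apply, hp3 x hx]
      change ‖U (T.base x) - T.base x‖ ≤ ε
      rw [h3, sub_self, norm_zero]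
      exact hε.le
  refine (ApproxOn.iUnion (fun _ _ hij => Set.image_mono (hmono hij)) h1).closure.mono ?_
  rw [← T.range_base, ← Set.image_iUnion]
  rintro _ ⟨x, rfl⟩
  exact map_mem_closure T.base.continuous (hdense x) (Set.mapsTo_image _ _)

/-! ### Countable ordinals and `ω`-skeletons -/

theorem exists_lt_omega_one_forall_le {ι : Type u} [Countable ι] (f : ι → Ordinal.{0})
    (hf : ∀ i, f i < ω₁) : ∃ β < ω₁, ∀ i, f i ≤ β :=
  ⟨⨆ i, f i, Ordinal.iSup_lt_omega_one hf, fun i => Ordinal.le_iSup f i⟩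

theorem countable_Iio_of_lt_omega_one {δ : Ordinal.{0}} (h : δ < ω₁) : (Set.Iio δ).Countable := by
  rw [← Cardinal.le_aleph0_iff_set_countable, Cardinal.mk_Iio_ordinal, Cardinal.lift_le_aleph0,
    ← Cardinal.lt_aleph_one_iff]
  rw [← Cardinal.lt_ord]
  simpa using h

/-- Every member of an `ω`-skeleton is `1`-complemented in the whole space. -/
theorem exists_projection_of_omegaSkeleton {X : Type u} [NormedAddCommGroup X] [NormedSpace ℝ X]
    [CompleteSpace X] {S : Ordinal.{0} → Submodule ℝ X}
    (hcl : ∀ α < ω₁, IsClosed (S α : Set X))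
    (hmono : ∀ α β, α ≤ β → β < ω₁ → S α ≤ S β)
    (hδ : ∀ α < ω₁, ∃ δ : DoubleArrow (S α) (S (Order.succ α)), ∀ x : S α, (δ.emb x : X) = x)
    (hlim : ∀ β < ω₁, Order.IsSuccLimit β → (S β : Set X) = closure (⋃ α < β, (S α : Set X)))
    (htotal : closure (⋃ α < ω₁, (S α : Set X)) = Set.univ) (α : Ordinal.{0}) (hα : α < ω₁) :
    ∃ p : X →ₗ[ℝ] X, (∀ x, ‖p x‖ ≤ ‖x‖) ∧ (∀ x, p x ∈ S α) ∧ ∀ x ∈ S α, p x = x := by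
  classical
  -- the chain is prolonged to all ordinals by the whole space
  let U : Ordinal.{0} → Submodule ℝ X := fun β => if β < ω₁ then S β else ⊤
  have hU1 : ∀ β < ω₁, U β = S β := fun β hβ => if_pos hβ
  have hU2 : ∀ β, ¬ β < ω₁ → U β = ⊤ := fun β hβ => if_neg hβ
  have hUmono : Monotone U := by
    intro β γ h
    by_cases hγ : γ < ω₁
    · rw [hU1 β (h.trans_lt hγ), hU1 γ hγ]
      exact hmono β γ h hγ
    · rw [hU2 γ hγ]
      exact le_top
  have hUlim : ∀ β, Order.IsSuccLimit β →
      (U β : Set X) = closure (⋃ γ < β, (U γ : Set X)) := by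
    intro β hβ
    rcases lt_trichotomy β ω₁ with h | rfl | h
    · rw [hU1 β h, hlim β h hβ]
      congr 1
      exact Set.iUnion₂_congr fun γ hγ => by rw [hU1 γ (hγ.trans h)]
    · rw [hU2 _ (lt_irrefl _), Submodule.top_coe, ← htotal]
      congr 1
      exact Set.iUnion₂_congr fun γ hγ => by rw [hU1 γ hγ]
    · rw [hU2 _ h.not_gt, Submodule.top_coe]
      refine (Set.eq_univ_of_univ_subset ?_).symm
      refine Set.Subset.trans ?_ subset_closure
      refine Set.Subset.trans ?_ (Set.subset_iUnion₂ ω₁ h)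
      rw [hU2 _ (lt_irrefl _)]
      exact subset_rfl
  have hUsucc : ∀ β, IsComplementedIn (U β) (U (Order.succ β)) := by
    intro β
    by_cases h : β < ω₁
    · rw [hU1 β h, hU1 _ ((Cardinal.isSuccLimit_omega 1).succ_lt h)]
      exact isComplementedIn_of_doubleArrow (hδ β h)
    · rw [hU2 β h, hU2 _ fun h' => h ((Order.le_succ β).trans_lt h')]
      exact IsComplementedIn.refl _
  have hbot : U (α + (⊥ : Ordinal.{0})) = S α := by
    rw [Ordinal.bot_eq_zero, add_zero, hU1 α hα]
  have : CompleteSpace (U (α + (⊥ : Ordinal.{0}))) := by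
    rw [hbot]
    exact (hcl α hα).completeSpace_coe
  obtain ⟨p, hp⟩ := exists_projection_of_chain (fun γ : Ordinal.{0} => U (α + γ))
    (fun β γ h => hUmono (by gcongr))
    (fun γ hγ => by
      rw [hUlim _ (Ordinal.isSuccLimit_add α hγ)]
      refine Set.Subset.antisymm (closure_mono (Set.iUnion₂_subset fun β hβ => ?_))
        (closure_mono (Set.iUnion₂_subset fun β hβ => ?_))
      · obtain ⟨d, hd, hβd⟩ := (Ordinal.lt_add_iff hγ.ne_bot).1 hβ
        exact (SetLike.coe_subset_coe.2 (hUmono hβd)).trans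
          (Set.subset_iUnion₂ (s := fun i (_ : i < γ) => (U (α + i) : Set X)) d hd)
      · exact Set.subset_iUnion₂ (s := fun i (_ : i < α + γ) => (U i : Set X)) (α + β)
          (by gcongr))
    (fun γ => by
      rw [Order.succ_eq_add_one, ← add_assoc]
      exact hUsucc (α + γ))
    (fun x => by
      refine subset_closure (Set.mem_iUnion.2 ⟨ω₁, ?_⟩)
      rw [hU2 _ (not_lt.2 (le_add_self))]
      trivial)
  rw [hbot] at hp
  exact ⟨p, hp⟩

theorem mk_le_continuum_of_isSeparable {E : Type u} [TopologicalSpace E]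
    [FirstCountableTopology E] [T2Space E] {s : Set E} (hs : TopologicalSpace.IsSeparable s) :
    #s ≤ 𝔠 := by
  obtain ⟨c, hc, hsc⟩ := hs
  exact (Cardinal.mk_le_mk_of_subset hsc).trans (mk_closure_le
    ((Cardinal.le_aleph0_iff_set_countable.2 hc).trans Cardinal.aleph0_le_continuum))

theorem mk_countableOrdinals : #CountableOrdinals = ℵ₁ := by
  rw [Cardinal.mk_toType, Ordinal.card_omega]

theorem mk_le_continuum_of_omegaSkeleton {X : Type u} [NormedAddCommGroup X] [NormedSpace ℝ X]
    {S : Ordinal.{0} → Submodule ℝ X}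
    (hsep : ∀ α < ω₁, TopologicalSpace.IsSeparable (S α : Set X))
    (htotal : closure (⋃ α < ω₁, (S α : Set X)) = Set.univ) : #X ≤ 𝔠 := by
  rw [← Cardinal.mk_univ, ← htotal]
  refine mk_closure_le ?_
  have : (⋃ α < ω₁, (S α : Set X)) ⊆ ⋃ j : CountableOrdinals,
      (S (Ordinal.ToType.mk.symm j : Set.Iio (ω₁ : Ordinal.{0})) : Set X) := by
    refine Set.iUnion₂_subset fun α hα x hx => Set.mem_iUnion.2 ⟨Ordinal.ToType.mk ⟨α, hα⟩, ?_⟩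
    rw [OrderIso.symm_apply_apply]
    exact hx
  refine (Cardinal.mk_le_mk_of_subset this).trans (mk_iUnion_le_continuum ?_ fun j => ?_)
  · rw [mk_countableOrdinals]
    exact Cardinal.aleph_one_le_continuum
  · exact mk_le_continuum_of_isSeparable (hsep _ (Ordinal.ToType.mk.symm j).2)

/-- Under the continuum hypothesis a set of cardinality at most that of the continuum injects into
the countable ordinals. -/
theorem exists_injective_rank (CH : Cardinal.continuum.{0} = Cardinal.aleph 1) {ι : Type u}
    (hι : #ι ≤ 𝔠) :
    ∃ r : ι → Ordinal.{0}, Function.Injective r ∧ ∀ i, r i < ω₁ := by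
  obtain ⟨f, hf⟩ := mk_le_continuum_iff.1 hι
  have h : #(Set ℕ) = #CountableOrdinals := by
    rw [Cardinal.mk_set_nat, CH, mk_countableOrdinals]
  obtain ⟨e⟩ := Cardinal.eq.1 h
  refine ⟨fun i => (Ordinal.ToType.mk.symm (e (f i)) : Set.Iio (ω₁ : Ordinal.{0})), ?_,
    fun i => (Ordinal.ToType.mk.symm (e (f i))).2⟩
  intro i k hik
  exact hf (e.injective (Ordinal.ToType.mk.symm.injective (Subtype.ext hik)))

namespace PushoutTower

variable {J : Type} [LinearOrder J] [SuccOrder J] [OrderBot J] [WellFoundedLT J] [NoMaxOrder J]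
  {X K : Type u} [NormedAddCommGroup X] [NormedSpace ℝ X] [NormedAddCommGroup K] [NormedSpace ℝ K]
  {T : PushoutTower J X K}

theorem mk_V_le (hJ : #J ≤ 𝔠) (hX : #X ≤ 𝔠) (j : J) : #(T.V j) ≤ 𝔠 := by
  induction j using WellFoundedLT.induction with
  | ind j ih =>
    rcases Order.isMin_or_mem_range_succ_or_isSuccLimit j with hj | ⟨k, rfl⟩ | hj
    · obtain rfl := hj.eq_bot
      rw [← T.range_base]
      exact mk_le_continuum_of_injective T.base.equivRange.symm.injective hX
    · have hk := ih k (Order.lt_succ k)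
      have hle := T.succ_le k
      rw [Submodule.iSup_eq_span, ← (T.V k).span_eq, ← Submodule.span_union] at hle
      refine (Cardinal.mk_le_mk_of_subset (SetLike.coe_subset_coe.2 hle)).trans
        (mk_closure_le (mk_span_le ?_))
      rw [Set.union_eq_iUnion]
      refine mk_iUnion_le_continuum ?_ ?_
      · exact (Cardinal.mk_le_aleph0).trans Cardinal.aleph0_le_continuum
      · rintro (_ | _)
        · refine mk_iUnion_le_continuum (T.mk_I_le k hk) fun a => ?_
          have hsurj : Function.Surjective (T.glue a).rangeRestrict :=
            LinearMap.surjective_rangeRestrict _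
          exact mk_le_continuum_of_injective (Function.injective_surjInv hsurj)
            (T.G a).mk_space_le
        · exact hk
    · have hlim : (T.V j : Set K) = closure (⋃ i : Set.Iio j, (T.V i : Set K)) := by
        rw [T.limit j hj]
        congr 1
        ext
        simp
      have : #(T.V j : Set K) ≤ 𝔠 := by
        rw [hlim]
        exact mk_closure_le (mk_iUnion_le_continuum
          ((Cardinal.mk_le_mk_of_subset (Set.subset_univ _)).trans
            (Cardinal.mk_univ.le.trans hJ)) fun i => ih i i.2)
      exact this

theorem mk_index_le (hJ : #J ≤ 𝔠) (hX : #X ≤ 𝔠) : #(Σ j, T.I j) ≤ 𝔠 :=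
  mk_sigma_le_continuum hJ fun j => T.mk_I_le j (mk_V_le hJ hX j)


theorem gen_mono_of_le {S : Ordinal.{0} → Submodule ℝ X}
    (hmono : ∀ α β, α ≤ β → β < ω₁ → S α ≤ S β) {γ γ' : Ordinal.{0}} (h : γ ≤ γ') (h' : γ' < ω₁)
    {C C' : Set (Σ j, T.I j)} (hC : C ⊆ C') : T.gen (S γ) C ≤ T.gen (S γ') C' :=
  gen_mono (hmono γ γ' h h') hC

/-- Every element of `V j` is generated by a member of the `ω`-skeleton of `X` and countably many
of the spaces attached before stage `j`. -/
theorem exists_countable_mem_gen {S : Ordinal.{0} → Submodule ℝ X}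
    (hmono : ∀ α β, α ≤ β → β < ω₁ → S α ≤ S β)
    (htotal : closure (⋃ α < ω₁, (S α : Set X)) = Set.univ) {j : J} {x : K} (hx : x ∈ T.V j) :
    ∃ γ < ω₁, ∃ C ⊆ T.below j, C.Countable ∧ x ∈ T.gen (S γ) C := by
  let M : Submodule ℝ K :=
    { carrier := {x | ∃ γ < ω₁, ∃ C ⊆ T.below j, C.Countable ∧ x ∈ T.gen (S γ) C}
      zero_mem' := ⟨0, Ordinal.omega_pos 1, ∅, Set.empty_subset _, Set.countable_empty,
        zero_mem _⟩
      add_mem' := by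
        rintro x y ⟨γ, hγ, C, hC, hCc, hx⟩ ⟨γ', hγ', C', hC', hCc', hy⟩
        have h := max_lt hγ hγ'
        exact ⟨max γ γ', h, C ∪ C', Set.union_subset hC hC', hCc.union hCc',
          add_mem (gen_mono_of_le hmono (le_max_left _ _) h Set.subset_union_left hx)
            (gen_mono_of_le hmono (le_max_right _ _) h Set.subset_union_right hy)⟩
      smul_mem' := by
        rintro c x ⟨γ, hγ, C, hC, hCc, hx⟩
        exact ⟨γ, hγ, C, hC, hCc, Submodule.smul_mem _ c hx⟩ }
  have hmem : ∀ {x}, x ∈ M ↔ ∃ γ < ω₁, ∃ C ⊆ T.below j, C.Countable ∧ x ∈ T.gen (S γ) C :=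
    Iff.rfl
  have hM : IsClosed (M : Set K) := by
    refine isSeqClosed_iff_isClosed.1 fun w x hw hx => ?_
    choose γ hγ C hC hCc hwC using fun n => hmem.1 (hw n)
    obtain ⟨β, hβ, hγβ⟩ := exists_lt_omega_one_forall_le γ hγ
    refine hmem.2 ⟨β, hβ, ⋃ n, C n, Set.iUnion_subset hC, Set.countable_iUnion hCc, ?_⟩
    exact (isClosed_gen _ _).mem_of_tendsto hx (Filter.Eventually.of_forall fun n =>
      gen_mono_of_le hmono (hγβ n) hβ (Set.subset_iUnion C n) (hwC n))
  have hle : T.V j ≤ M := by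
    refine V_le_of_mem hM (fun x => ?_) fun s hs z => ?_
    · have hx : x ∈ closure (⋃ α < ω₁, (S α : Set X)) := htotal ▸ Set.mem_univ x
      refine hM.closure_subset (map_mem_closure T.base.continuous hx ?_)
      intro y hy
      obtain ⟨γ, hγ, hy⟩ := Set.mem_iUnion₂.1 hy
      exact hmem.2 ⟨γ, hγ, ∅, Set.empty_subset _, Set.countable_empty, base_mem_gen _ hy⟩
    · exact hmem.2 ⟨0, Ordinal.omega_pos 1, {s}, Set.singleton_subset_iff.2 hs,
        Set.countable_singleton s, glue_mem_gen _ (Set.mem_singleton s) z⟩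
  exact hmem.1 (hle hx)

/-- Every index belongs to a countable set which, together with a member of the `ω`-skeleton of
`X`, is saturated. -/
theorem exists_countable_saturated {S : Ordinal.{0} → Submodule ℝ X}
    (hmono : ∀ α β, α ≤ β → β < ω₁ → S α ≤ S β)
    (htotal : closure (⋃ α < ω₁, (S α : Set X)) = Set.univ) (s : Σ j, T.I j) :
    ∃ γ < ω₁, ∃ C : Set (Σ j, T.I j), C.Countable ∧ s ∈ C ∧ T.Saturated (S γ) C := by
  obtain ⟨j, a⟩ := s
  induction j using WellFoundedLT.induction with
  | ind j ih =>
    let b : Module.Basis (Fin (T.F a).dim) ℝ (T.F a).Space := Pi.basisFun ℝ _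
    choose γ hγ C hC hCc hgen using fun k =>
      exists_countable_mem_gen hmono htotal (T.glue_emb_mem a (b k))
    have ih' : ∀ v : ⋃ k, C k, ∃ γ < ω₁, ∃ D : Set (Σ j, T.I j),
        D.Countable ∧ (v : Σ j, T.I j) ∈ D ∧ T.Saturated (S γ) D := by
      rintro ⟨⟨i, c⟩, hv⟩
      obtain ⟨k, hk⟩ := Set.mem_iUnion.1 hv
      exact ih i (hC k hk) c
    choose γ' hγ' D hDc hvD hD using ih'
    have hCc' : (⋃ k, C k).Countable := Set.countable_iUnion hCc
    have : Countable (⋃ k, C k) := hCc'.to_subtype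
    obtain ⟨β, hβ, hγβ⟩ := exists_lt_omega_one_forall_le γ hγ
    obtain ⟨β', hβ', hγβ'⟩ := exists_lt_omega_one_forall_le γ' hγ'
    have hmax := max_lt hβ hβ'
    refine ⟨max β β', hmax, insert ⟨j, a⟩ (⋃ v, D v),
      (Set.countable_iUnion hDc).insert _, Set.mem_insert _ _, ?_⟩
    rintro t ht y
    rcases Set.mem_insert_iff.1 ht with rfl | ht
    · have hle : (⊤ : Submodule ℝ (T.F a).Space) ≤
          (T.gen (S (max β β')) (insert ⟨j, a⟩ (⋃ v, D v) ∩ T.below j)).comap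
            (T.glue a ∘ₗ (T.u a).emb.toLinearMap) := by
        rw [← b.span_eq, Submodule.span_le]
        rintro _ ⟨k, rfl⟩
        refine gen_mono_of_le hmono ((hγβ k).trans (le_max_left _ _)) hmax ?_ (hgen k)
        intro v hv
        have hv' : v ∈ ⋃ k, C k := Set.mem_iUnion.2 ⟨k, hv⟩
        exact ⟨Set.mem_insert_of_mem _ (Set.mem_iUnion.2 ⟨⟨v, hv'⟩, hvD ⟨v, hv'⟩⟩), hC k hv⟩
      exact hle (Submodule.mem_top (x := y))
    · obtain ⟨v, hv⟩ := Set.mem_iUnion.1 ht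
      refine gen_mono_of_le hmono ((hγβ' v).trans (le_max_right _ _)) hmax ?_ (hD v t hv y)
      exact Set.inter_subset_inter_left _
        ((Set.subset_iUnion D v).trans (Set.subset_insert _ _))

theorem isSeparable_gen {A : Submodule ℝ X} (hA : TopologicalSpace.IsSeparable (A : Set X))
    {C : Set (Σ j, T.I j)} (hC : C.Countable) :
    TopologicalSpace.IsSeparable (T.gen A C : Set K) := by
  have h1 : TopologicalSpace.IsSeparable
      (T.base '' A ∪ ⋃ s ∈ C, Set.range (T.glue s.2)) := by
    have := hC.to_subtype
    rw [Set.biUnion_eq_iUnion]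
    refine (hA.image T.base.continuous).union (.iUnion fun s => ?_)
    have : Continuous (T.glue s.1.2) := LinearMap.continuous_of_finiteDimensional _
    have := FiniteDimensional.proper ℝ (T.G s.1.2).Space
    exact TopologicalSpace.isSeparable_range ‹Continuous (T.glue s.1.2)›
  refine TopologicalSpace.IsSeparable.mono (h1.span (R := ℝ)).closure ?_
  refine SetLike.coe_subset_coe.2
    (gen_le (M := (Submodule.span ℝ _).topologicalClosure) isClosed_closure (fun x hx => ?_)
      fun s hs z => ?_)
  · exact subset_closure (Submodule.subset_span (Or.inl ⟨x, hx, rfl⟩))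
  · exact subset_closure (Submodule.subset_span (Or.inr (Set.mem_biUnion hs ⟨z, rfl⟩)))

/-- The inclusion of a subspace in a larger one, completed to a double arrow by a projection. -/
theorem exists_doubleArrow_of_projection {A B : Submodule ℝ K} (hAB : A ≤ B) (Q : K →L[ℝ] K)
    (hQ : ‖Q‖ ≤ 1) (hQA : ∀ x, Q x ∈ A) (hQx : ∀ x ∈ A, Q x = x) :
    ∃ δ : DoubleArrow A B, ∀ x : A, (δ.emb x : K) = x := by
  refine ⟨⟨⟨Submodule.inclusion hAB, fun _ => rfl⟩,
    (Q.comp B.subtypeL).codRestrict A fun x => hQA x, ?_, fun a => Subtype.ext (hQx a a.2)⟩,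
    fun _ => rfl⟩
  refine ContinuousLinearMap.opNorm_le_bound _ zero_le_one fun x => ?_
  exact Q.le_of_opNorm_le hQ x

/-- A tower with at most continuum many push-outs has an `ω`-skeleton when its base has one, under
the continuum hypothesis. Every index `s` is put in a countable saturated set `C s`, and gets a
countable ordinal `rk s` in such a way that countably many indices have rank less than a given
`δ < ω₁`; the members of the `ω`-skeleton are generated by the sets `C s` with `rk s < δ`. -/
theorem hasOmegaSkeleton [CompleteSpace X] [CompleteSpace K] (T : PushoutTower J X K)
    (CH : Cardinal.continuum.{0} = Cardinal.aleph 1) (hJ : #J ≤ 𝔠) (hX : HasOmegaSkeleton X) :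
    HasOmegaSkeleton K := by
  obtain ⟨S, hcs, hmono, hδ, hlim, htotal⟩ := hX
  have hXc := mk_le_continuum_of_omegaSkeleton (fun α hα => (hcs α hα).2) htotal
  obtain ⟨r, hr, hrlt⟩ := exists_injective_rank CH (mk_index_le (T := T) hJ hXc)
  choose γ hγ C hCc hsC hC using exists_countable_saturated (T := T) hmono htotal
  let rk : (Σ j, T.I j) → Ordinal.{0} := fun s => max (r s) (γ s)
  have hrk : ∀ s, rk s < ω₁ := fun s => max_lt (hrlt s) (hγ s)
  let D : Ordinal.{0} → Set (Σ j, T.I j) := fun δ => ⋃ s ∈ {s | rk s < δ}, C s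
  have hDmono : Monotone D := fun α β h =>
    Set.biUnion_subset_biUnion_left fun s (hs : rk s < α) => hs.trans_le h
  have hDc : ∀ δ < ω₁, (D δ).Countable := by
    intro δ h
    refine Set.Countable.biUnion ?_ fun s _ => hCc s
    refine Set.Countable.mono (s₂ := r ⁻¹' Set.Iio δ) (fun s hs => ?_)
      ((countable_Iio_of_lt_omega_one h).preimage hr)
    exact (le_max_left (r s) (γ s)).trans_lt hs
  have hsat : ∀ δ < ω₁, T.Saturated (S δ) (D δ) := by
    intro δ h t ht y
    obtain ⟨s, hs, hts⟩ := Set.mem_iUnion₂.1 ht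
    refine gen_mono_of_le hmono ((le_max_right _ _).trans_lt hs).le h ?_ (hC s t hts y)
    exact Set.inter_subset_inter_left _
      (Set.subset_biUnion_of_mem (u := fun s => C s) (show s ∈ {s | rk s < δ} from hs))
  let W : Ordinal.{0} → Submodule ℝ K := fun δ => T.gen (S δ) (D δ)
  have hW : ∀ α β, α ≤ β → β < ω₁ → W α ≤ W β := fun α β h h' =>
    gen_mono_of_le hmono h h' (hDmono h)
  have hunion : ∀ β ≤ ω₁, Order.IsSuccLimit β → ∃ M : Submodule ℝ K,
      (M : Set K) = closure (⋃ δ < β, (W δ : Set K)) ∧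
      (∀ x ∈ closure (⋃ δ < β, (S δ : Set X)), T.base x ∈ M) ∧
      ∀ s ∈ D β, ∀ z, T.glue s.2 z ∈ M := by
    intro β hβ hlimβ
    have : Nonempty (Set.Iio β) := ⟨⟨⊥, hlimβ.bot_lt⟩⟩
    have hdir : Directed (· ≤ ·) fun δ : Set.Iio β => W δ :=
      Monotone.directed_le fun a b hab => hW a b hab (lt_of_lt_of_le b.2 hβ)
    have hM : ((⨆ δ : Set.Iio β, W δ).topologicalClosure : Set K) =
        closure (⋃ δ < β, (W δ : Set K)) := by
      rw [Submodule.topologicalClosure_coe, Submodule.coe_iSup_of_directed _ hdir]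
      congr 1
      ext
      simp
    refine ⟨_, hM, fun x hx => ?_, fun s hs z => ?_⟩
    · rw [← SetLike.mem_coe, hM]
      refine map_mem_closure T.base.continuous hx fun y hy => ?_
      obtain ⟨δ, hδ, hy⟩ := Set.mem_iUnion₂.1 hy
      exact Set.mem_iUnion₂.2 ⟨δ, hδ, base_mem_gen _ hy⟩
    · rw [← SetLike.mem_coe, hM]
      obtain ⟨s', hs', hss'⟩ := Set.mem_iUnion₂.1 hs
      refine subset_closure (Set.mem_iUnion₂.2
        ⟨Order.succ (rk s'), hlimβ.succ_lt hs', glue_mem_gen _ ?_ z⟩)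
      exact Set.mem_iUnion₂.2 ⟨s', Order.lt_succ (rk s'), hss'⟩
  refine ⟨W, fun α hα => ⟨isClosed_gen _ _, isSeparable_gen (hcs α hα).2 (hDc α hα)⟩, hW,
    fun α hα => ?_, fun β hβ hlimβ => ?_, ?_⟩
  · obtain ⟨p, hp1, hp2, hp3⟩ := exists_projection_of_omegaSkeleton (fun α hα => (hcs α hα).1)
      hmono hδ hlim htotal α hα
    obtain ⟨Q, hQ1, hQ2, hQ3⟩ := (hsat α hα).exists_projection p hp1 hp2 hp3
    exact exists_doubleArrow_of_projection
      (hW α _ (Order.le_succ α) ((Cardinal.isSuccLimit_omega 1).succ_lt hα)) Q hQ1 hQ2 hQ3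
  · obtain ⟨M, hM, hM1, hM2⟩ := hunion β hβ.le hlimβ
    refine Set.Subset.antisymm ?_ (closure_minimal
      (Set.iUnion₂_subset fun δ hδ => hW δ β hδ.le hβ) (isClosed_gen _ _))
    rw [← hM]
    refine SetLike.coe_subset_coe.2 (gen_le (hM ▸ isClosed_closure) (fun x hx => hM1 x ?_) hM2)
    rw [← hlim β hβ hlimβ]
    exact hx
  · obtain ⟨M, hM, hM1, hM2⟩ := hunion ω₁ le_rfl (Cardinal.isSuccLimit_omega 1)
    have hMc : IsClosed (M : Set K) := hM ▸ isClosed_closure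
    rw [← hM]
    refine Set.eq_univ_of_forall fun x => hMc.closure_subset_iff.2
      (Set.iUnion_subset fun j => ?_) (T.total x)
    refine SetLike.coe_subset_coe.2 (V_le_of_mem hMc (fun x => hM1 x (htotal ▸ Set.mem_univ x))
      fun s _ z => hM2 s (Set.mem_iUnion₂.2 ⟨s, hrk s, hsC s⟩) z)

end PushoutTower

end ComplDisp

theorem mainTheorem10 (CH : Cardinal.continuum.{0} = Cardinal.aleph 1)
    (X : Type u) [NormedAddCommGroup X] [NormedSpace ℝ X] [CompleteSpace X] :
    (ComplDisp.HasOmegaSkeleton X → ComplDisp.HasOmegaSkeleton (ComplDisp.KOmegaOne X)) ∧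
    (ComplDisp.HasSkeleton X → ComplDisp.HasBAP (ComplDisp.KOmegaOne X)) := by
  have := ComplDisp.noMaxOrder_countableOrdinals
  refine ⟨fun hX => (ComplDisp.kTower X).hasOmegaSkeleton CH ?_ hX, fun hX => ⟨1, ?_⟩⟩
  · rw [ComplDisp.mk_countableOrdinals]
    exact Cardinal.aleph_one_le_continuum
  · exact (ComplDisp.PushoutTower.approxOn_univ
      ((ComplDisp.kTower X).approxOn_bot hX)).hasBAPWith
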